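/- Let $\Bbbk$ be a field of characteristic different from $2$, and let $\mathbf{A}=\mathbf{A}_{\overline 0}\oplus\mathbf{A}_{\overline 1}$ be a super-coalgebra over $\Bbbk$, i.e. a coassociative counital coalgebra on a $\mathbb{Z}/2$-graded $\Bbbk$-vector space whose coproduct $\Delta$ and counit $\epsilon$ preserve parity ($\Bbbk$ being purely even). Assume that $\mathbf{A}$ is super-cocommutative: $\Delta=c\circ\Delta$, where $c(v\otimes w)=(-1)^{|v||w|}w\otimes v$ for homogeneous $v,w$. A sub-super-coalgebra of $\mathbf{A}$ is a graded subspace $B$ with $\Delta(B)\subseteq B\otimes B$; it is simple if it is nonzero and contains no sub-super-coalgebra other than $0$ and itself. For subspaces $X,Y$ of $\mathbf{A}$ the wedge $X\sqcap Y$ is the kernel of $\mathbf{A}\xrightarrow{\Delta}\mathbf{A}\otimes\mathbf{A}\to\mathbf{A}/X\otimes\mathbf{A}/Y$. The coradical filtration of $\mathbf{A}$ is defined by letting $\mathbf{A}_0$ be the coradical, that is, the sum of all simple sub-super-coalgebras, and $\mathbf{A}_{n+1}=\mathbf{A}_n\sqcap\mathbf{A}_0$ for $n\ge 0$. One says that $\mathbf{A}$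 is of finite type if $\mathbf{A}_1$ is finite-dimensional, and locally finite if $X\sqcap Y$ is finite-dimensional for all finite-dimensional graded subspaces $X,Y$ of $\mathbf{A}$. The full linear dual $\mathbf{A}^*=\mathrm{Hom}_\Bbbk(\mathbf{A},\Bbbk)$ is a superalgebra under the product dual to $\Delta$. A superideal is a graded two-sided ideal, and a superalgebra is called Noetherian if it satisfies the ascending chain condition on superideals. For a superalgebra $R$, $R^\circ$ is the super-coalgebra of all linear functionals on $R$ that vanish on some superideal of finite codimension, with the coproduct dual to the product of $R$ and with evaluation at $1$ as counit. One says that $\mathbf{A}$ is reflexive if the canonical map $\mathbf{A}\to(\mathbf{A}^*)^\circ$, $a\mapsto(f\mapsto f(a))$, is an isomorphism of super-coalgebras. Then the following conditions are equivalent: 1. $\mathbf{A}$ is of finite type. 2. $\mathbf{A}_n$ is finite-dimensional for all $n\ge 0$. 3. $\mathbf{A}$ is locally finite and $\mathbf{A}_0$ is finite-dimensional. 4. $\mathbf{A}_0$ is finite-dimensional and $\mathbf{A}$ is reflexive. 5. $\mathbf{A}^*$ is Noetherian. 6. The sub-super-coalgebras of $\mathbf{A}$ satisfy the descending chain condition.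 -/

import Mathlib

open scoped TensorProduct

noncomputable section

namespace SuperCoalg

/-! ### Super vector spaces

A super vector space is a vector space `V` with a decomposition `𝒱 : ZMod 2 → Submodule k V`;
a sub super vector space is a submodule `X` with `X.IsHomogeneous 𝒱`. -/

/-- The projection of a super vector space onto its component of parity `i`. -/
def proj (k : Type*) [Field k] {V : Type*} [AddCommGroup V] [Module k V]
    (𝒱 : ZMod 2 → Submodule k V) [DirectSum.Decomposition 𝒱] (i : ZMod 2) : V →ₗ[k] V :=
  (𝒱 i).subtype ∘ₗ DirectSum.component k (ZMod 2) (fun j => 𝒱 j) i ∘ₗ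
    (DirectSum.decomposeLinearEquiv 𝒱).toLinearMap

section proj

variable {k : Type*} [Field k] {V : Type*} [AddCommGroup V] [Module k V]
  (𝒱 : ZMod 2 → Submodule k V) [DirectSum.Decomposition 𝒱]

theorem proj_apply (i : ZMod 2) (v : V) :
    proj k 𝒱 i v = (DirectSum.decompose 𝒱 v i : V) := rfl

theorem proj_mem (i : ZMod 2) (v : V) : proj k 𝒱 i v ∈ 𝒱 i :=
  (DirectSum.decompose 𝒱 v i).2

theorem proj_of_mem {i : ZMod 2} {v : V} (h : v ∈ 𝒱 i) : proj k 𝒱 i v = v := by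
  rw [proj_apply, DirectSum.decompose_of_mem_same 𝒱 h]

theorem proj_of_mem_ne {i j : ZMod 2} (hij : i ≠ j) {v : V} (h : v ∈ 𝒱 i) :
    proj k 𝒱 j v = 0 := by
  rw [proj_apply, DirectSum.decompose_of_mem_ne 𝒱 h hij]

theorem sum_proj (v : V) : ∑ i : ZMod 2, proj k 𝒱 i v = v := by
  classical
  simp only [proj_apply]
  conv_rhs => rw [← DirectSum.sum_support_decompose 𝒱 v]
  symm
  apply Finset.sum_subset (Finset.subset_univ _)
  intro i _ hi
  simpa using hi

end proj

/-- A `ZMod 2`-grading obtained from a family of projections. -/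
@[reducible] def decompositionOfProj {k : Type*} [Field k] {V : Type*} [AddCommMonoid V]
    [Module k V] (𝒱 : ZMod 2 → Submodule k V) (p : ZMod 2 → V →ₗ[k] V)
    (hmem : ∀ i v, p i v ∈ 𝒱 i) (hsum : ∀ v, ∑ i, p i v = v)
    (hne : ∀ i j, i ≠ j → ∀ v ∈ 𝒱 i, p j v = 0) : DirectSum.Decomposition 𝒱 :=
  DirectSum.Decomposition.ofLinearMap 𝒱
    (∑ i, DirectSum.lof k (ZMod 2) (fun j => 𝒱 j) i ∘ₗ (p i).codRestrict (𝒱 i) (hmem i))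
    (by
      ext v
      simp [hsum])
    (by
      ext i v : 2
      have hs : p i (v : V) = v := by
        have := hsum (v : V)
        rwa [Finset.sum_eq_single i (fun j _ hj => hne i j (Ne.symm hj) _ v.2)
          (by simp)] at this
      simp only [LinearMap.comp_apply, LinearMap.sum_apply, LinearMap.id_apply,
        DirectSum.coeLinearMap_lof]
      rw [Finset.sum_eq_single i]
      · congr 1
        exact Subtype.ext hs
      · intro j _ hj
        have : (p j).codRestrict (𝒱 j) (hmem j) (v : V) = 0 :=
          Subtype.ext (hne i j (Ne.symm hj) _ v.2)
        rw [this, map_zero]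
      · simp)

/-- The twisting map `v ⊗ w ↦ (-1)^(|v||w|) w ⊗ v` of a super vector space with itself. -/
def superTwist (k : Type*) [Field k] {V : Type*} [AddCommGroup V] [Module k V]
    (𝒱 : ZMod 2 → Submodule k V) [DirectSum.Decomposition 𝒱] : V ⊗[k] V →ₗ[k] V ⊗[k] V :=
  ∑ i : ZMod 2, ∑ j : ZMod 2, ((-1 : k) ^ (i.val * j.val)) •
    ((TensorProduct.comm k V V).toLinearMap ∘ₗ TensorProduct.map (proj k 𝒱 i) (proj k 𝒱 j))

theorem superTwist_tmul {k : Type*} [Field k] {V : Type*} [AddCommGroup V] [Module k V]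
    (𝒱 : ZMod 2 → Submodule k V) [DirectSum.Decomposition 𝒱] {i j : ZMod 2} {v w : V}
    (hv : v ∈ 𝒱 i) (hw : w ∈ 𝒱 j) :
    superTwist k 𝒱 (v ⊗ₜ[k] w) = ((-1 : k) ^ (i.val * j.val)) • (w ⊗ₜ[k] v) := by
  simp only [superTwist, LinearMap.sum_apply, LinearMap.smul_apply, LinearMap.comp_apply,
    TensorProduct.map_tmul, LinearEquiv.coe_coe, TensorProduct.comm_tmul]
  rw [Finset.sum_eq_single i, Finset.sum_eq_single j, proj_of_mem 𝒱 hv, proj_of_mem 𝒱 hw]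
  · intro j' _ h
    simp [proj_of_mem_ne 𝒱 (Ne.symm h) hw]
  · simp
  · intro i' _ h
    simp [proj_of_mem_ne 𝒱 (Ne.symm h) hv]
  · simp

/-! ### Super-coalgebras -/

/-- A coassociative counital coalgebra on a super vector space is a super-coalgebra if its
coproduct and counit are even maps. -/
class IsSuperCoalgebra (k : Type*) [Field k] {A : Type*} [AddCommMonoid A] [Module k A]
    [Coalgebra k A] (𝒜 : ZMod 2 → Submodule k A) : Prop where
  comul_mem : ∀ n : ZMod 2, ∀ a ∈ 𝒜 n, Coalgebra.comul (R := k) a ∈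
    ⨆ i : ZMod 2, LinearMap.range (TensorProduct.mapIncl (𝒜 i) (𝒜 (n - i)))
  counit_eq_zero : ∀ a ∈ 𝒜 1, Coalgebra.counit (R := k) a = 0

section Coalgebra

variable (k : Type*) [Field k] {A : Type*} [AddCommGroup A] [Module k A] [Coalgebra k A]

/-- The wedge of `X` and `Y`: the kernel of `A → A ⊗ A → A/X ⊗ A/Y`. -/
def wedge (X Y : Submodule k A) : Submodule k A :=
  LinearMap.ker (TensorProduct.map X.mkQ Y.mkQ ∘ₗ (Coalgebra.comul : A →ₗ[k] A ⊗[k] A))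

/-- Iterated wedges of `X` with itself. -/
def wedgePow (X : Submodule k A) : ℕ → Submodule k A
  | 0 => ⊥
  | 1 => X
  | n + 2 => wedge k (wedgePow X (n + 1)) X

variable (𝒜 : ZMod 2 → Submodule k A) [DirectSum.Decomposition 𝒜]

/-- `Δ = c ∘ Δ` for the twisting map `c`. -/
def IsSuperCocommutative : Prop :=
  superTwist k 𝒜 ∘ₗ (Coalgebra.comul : A →ₗ[k] A ⊗[k] A) = Coalgebra.comul

/-- Sub-super-coalgebras: sub super vector spaces `B` with `Δ(B) ⊆ B ⊗ B`. -/
def IsSubSuperCoalgebra (B : Submodule k A) : Prop :=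
  B.IsHomogeneous 𝒜 ∧
    ∀ b ∈ B, Coalgebra.comul (R := k) b ∈ LinearMap.range (TensorProduct.mapIncl B B)

/-- Simple sub-super-coalgebras. -/
def IsSimpleSubSuperCoalgebra (B : Submodule k A) : Prop :=
  IsSubSuperCoalgebra k 𝒜 B ∧ B ≠ ⊥ ∧
    ∀ C : Submodule k A, IsSubSuperCoalgebra k 𝒜 C → C ≤ B → C = ⊥ ∨ C = B

/-- The coradical: the sum of all simple sub-super-coalgebras. -/
def corad : Submodule k A :=
  sSup {B | IsSimpleSubSuperCoalgebra k 𝒜 B}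

/-- The `n`-th term `A_n` of the coradical filtration. -/
def coradFiltration (n : ℕ) : Submodule k A :=
  wedgePow k (corad k 𝒜) (n + 1)

/-- `A` is of finite type if `A_1` is finite-dimensional. -/
def IsFiniteType : Prop :=
  FiniteDimensional k (coradFiltration k 𝒜 1)

/-- `A` is locally finite if the wedge of any two finite-dimensional sub super vector spaces is
finite-dimensional. -/
def IsLocallyFinite : Prop :=
  ∀ X Y : Submodule k A, X.IsHomogeneous 𝒜 → Y.IsHomogeneous 𝒜 →
    FiniteDimensional k X → FiniteDimensional k Y → FiniteDimensional k (wedge k X Y)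

/-- The descending chain condition for sub-super-coalgebras. -/
def SubSuperCoalgebraDCC : Prop :=
  ∀ B : ℕ → Submodule k A, (∀ n, IsSubSuperCoalgebra k 𝒜 (B n)) → (∀ n, B (n + 1) ≤ B n) →
    ∃ N, ∀ n, N ≤ n → B n = B N

end Coalgebra

/-! ### Superideals -/

section Superideal

variable {k : Type*} [Field k] {R : Type*} [Ring R] [Algebra k R]
  (𝓡 : ZMod 2 → Submodule k R) [GradedAlgebra 𝓡]

/-- Superideals: homogeneous two-sided ideals. -/
def IsSuperideal (I : Ideal R) : Prop :=
  I.IsTwoSided ∧ I.IsHomogeneous 𝓡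

/-- A superalgebra is Noetherian if it has the ascending chain condition on superideals. -/
def IsNoetherianSuper : Prop :=
  ∀ I : ℕ → Ideal R, (∀ n, IsSuperideal 𝓡 (I n)) → (∀ n, I n ≤ I (n + 1)) →
    ∃ N, ∀ n, N ≤ n → I n = I N

end Superideal

/-! ### The dual superalgebra of a super-coalgebra

The algebra structure on the full dual `A* = Hom(A, k)` is the convolution product
`(f * g)(a) = ∑ f(a₁) g(a₂)` with unit the counit. -/

section Dual

variable (k : Type*) [Field k] {A : Type*} [AddCommGroup A] [Module k A]
  (𝒜 : ZMod 2 → Submodule k A)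

/-- The component of parity `i` of `A*`: the functionals vanishing on the other component. -/
def dualGrading (i : ZMod 2) : Submodule k (WithConv (A →ₗ[k] k)) where
  carrier := {f | ∀ j, j ≠ i → ∀ a ∈ 𝒜 j, f.ofConv a = 0}
  add_mem' := by
    intro f g hf hg j hj a ha
    simp [hf j hj a ha, hg j hj a ha]
  zero_mem' := by
    intro j hj a ha
    simp
  smul_mem' := by
    intro c f hf j hj a ha
    simp [hf j hj a ha]

instance [DirectSum.Decomposition 𝒜] : DirectSum.Decomposition (dualGrading k 𝒜) :=
  decompositionOfProj (dualGrading k 𝒜)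
    (fun i => (WithConv.linearEquiv k (A →ₗ[k] k)).symm.toLinearMap ∘ₗ
      LinearMap.lcomp k k (proj k 𝒜 i) ∘ₗ (WithConv.linearEquiv k (A →ₗ[k] k)).toLinearMap)
    (by
      intro i f j hj a ha
      simp [proj_of_mem_ne 𝒜 hj ha])
    (by
      intro f
      apply (WithConv.linearEquiv k (A →ₗ[k] k)).injective
      rw [map_sum]
      ext a
      rw [LinearMap.sum_apply]
      conv_rhs => rw [← sum_proj (k := k) 𝒜 a, map_sum]
      simp)
    (by
      intro i j hij f hf
      apply WithConv.ext
      ext a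
      simpa using hf j (Ne.symm hij) _ (proj_mem 𝒜 j a))

instance [Coalgebra k A] [DirectSum.Decomposition 𝒜] [IsSuperCoalgebra k 𝒜] :
    GradedAlgebra (dualGrading k 𝒜) where
  one_mem := by
    intro j hj a ha
    have : ∀ j : ZMod 2, j ≠ 0 → j = 1 := by decide
    obtain rfl := this j hj
    simp [LinearMap.convOne_def, IsSuperCoalgebra.counit_eq_zero a ha]
  mul_mem := by
    intro i j f g hf hg n hn a ha
    have h := IsSuperCoalgebra.comul_mem (k := k) n a ha
    have hle : (⨆ i : ZMod 2, LinearMap.range (TensorProduct.mapIncl (𝒜 i) (𝒜 (n - i)))) ≤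
        LinearMap.ker (LinearMap.mul' k k ∘ₗ TensorProduct.map f.ofConv g.ofConv) := by
      refine iSup_le fun p => ?_
      rw [LinearMap.range_le_ker_iff]
      apply TensorProduct.ext'
      intro x y
      by_cases hp : p = i
      · have hq : n - p ≠ j := by
          rintro rfl
          apply hn
          rw [← hp]
          ring
        simp [TensorProduct.mapIncl, hg _ hq _ y.2]
      · simp [TensorProduct.mapIncl, hf _ hp _ x.2]
    exact hle h

end Dual

/-! ### The finite dual of a superalgebra -/

/-- The functionals on `M ⊗ N` defined by elements of `M* ⊗ N*` determine these elements. -/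
theorem dualDistrib_injective (k M N : Type*) [Field k] [AddCommGroup M] [Module k M]
    [AddCommGroup N] [Module k N] :
    Function.Injective (TensorProduct.dualDistrib k M N) := by
  rw [injective_iff_map_eq_zero]
  intro t ht
  let b := Module.Basis.ofVectorSpace k (Module.Dual k N)
  obtain ⟨c, rfl⟩ := TensorProduct.eq_repr_basis_right b t
  have hc : c = 0 := by
    ext i m
    have h1 : ∑ j ∈ c.support, (c j m) • b j = 0 := by
      ext n
      have := LinearMap.congr_fun ht (m ⊗ₜ n)
      simpa [Finsupp.sum, map_sum, LinearMap.sum_apply] using this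
    by_cases hi : i ∈ c.support
    · exact linearIndependent_iff'.1 b.linearIndependent _ _ h1 i hi
    · simp [Finsupp.notMem_support_iff.1 hi]
  simp [hc]

section FiniteDual

variable (k : Type*) [Field k] {R : Type*} [Ring R] [Algebra k R]
  (𝓡 : ZMod 2 → Submodule k R) [GradedAlgebra 𝓡]

/-- `R°`: the functionals on `R` vanishing on some superideal of finite codimension. -/
def finiteDual : Submodule k (Module.Dual k R) where
  carrier := {f | ∃ I : Ideal R, IsSuperideal 𝓡 I ∧ FiniteDimensional k (R ⧸ I) ∧
    ∀ x ∈ I, f x = 0}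
  add_mem' := by
    rintro f g ⟨I, ⟨hI1, hI2⟩, hI3, hf⟩ ⟨J, ⟨hJ1, hJ2⟩, hJ3, hg⟩
    refine ⟨I ⊓ J, ⟨⟨fun b ha => ⟨I.mul_mem_right b ha.1, J.mul_mem_right b ha.2⟩⟩, hI2.inf hJ2⟩, ?_, ?_⟩
    · let φ : R →ₗ[R] (R ⧸ I) × (R ⧸ J) := LinearMap.prod I.mkQ J.mkQ
      have hφ : LinearMap.ker φ = I ⊓ J := by
        simp [φ, LinearMap.ker_prod]
      let ψ := (Submodule.liftQ (I ⊓ J) φ hφ.ge).restrictScalars k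
      have hψ : Function.Injective ψ := by
        change Function.Injective (Submodule.liftQ (I ⊓ J) φ hφ.ge)
        rw [← LinearMap.ker_eq_bot]
        exact Submodule.ker_liftQ_eq_bot _ _ _ hφ.le
      exact FiniteDimensional.of_injective ψ hψ
    · intro x hx
      simp [hf x hx.1, hg x hx.2]
  zero_mem' := ⟨⊤, ⟨inferInstance, Ideal.IsHomogeneous.top 𝓡⟩, inferInstance, by simp⟩
  smul_mem' := by
    rintro c f ⟨I, hI, hI3, hf⟩
    exact ⟨I, hI, hI3, fun x hx => by simp [hf x hx]⟩

instance : Module.Free k (finiteDual k 𝓡) :=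
  Module.Free.of_divisionRing k (finiteDual k 𝓡)

/-- The component of parity `i` of `R°`: the functionals vanishing on the other component of
`R`. -/
def finiteDualGrading (i : ZMod 2) : Submodule k (finiteDual k 𝓡) where
  carrier := {f | ∀ j, j ≠ i → ∀ x ∈ 𝓡 j, (f : Module.Dual k R) x = 0}
  add_mem' := by
    intro f g hf hg j hj x hx
    simp [hf j hj x hx, hg j hj x hx]
  zero_mem' := by
    intro j hj x hx
    simp
  smul_mem' := by
    intro c f hf j hj x hx
    simp [hf j hj x hx]

/-- The projections of `R°` onto its components: `f ↦ f ∘ proj i`. -/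
def finiteDualProj (i : ZMod 2) : finiteDual k 𝓡 →ₗ[k] finiteDual k 𝓡 :=
  ((LinearMap.lcomp k k (proj k 𝓡 i)) ∘ₗ (finiteDual k 𝓡).subtype).codRestrict
    (finiteDual k 𝓡) (by
      rintro ⟨f, I, hI, hI3, hf⟩
      exact ⟨I, hI, hI3, fun x hx => hf _ (hI.2 i hx)⟩)

instance : DirectSum.Decomposition (finiteDualGrading k 𝓡) :=
  decompositionOfProj (finiteDualGrading k 𝓡)
    (finiteDualProj k 𝓡)
    (by
      intro i f j hj x hx
      simp [finiteDualProj, proj_of_mem_ne 𝓡 hj hx])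
    (by
      intro f
      ext x
      conv_rhs => rw [← sum_proj (k := k) 𝓡 x, map_sum]
      simp [finiteDualProj])
    (by
      intro i j hij f hf
      ext x
      simpa [finiteDualProj] using hf j (Ne.symm hij) _ (proj_mem 𝓡 j x))

/-- The pairing of `R° ⊗ R°` with `R ⊗ R`. -/
def pairing : finiteDual k 𝓡 ⊗[k] finiteDual k 𝓡 →ₗ[k] Module.Dual k (R ⊗[k] R) :=
  TensorProduct.dualDistrib k R R ∘ₗ TensorProduct.mapIncl (finiteDual k 𝓡) (finiteDual k 𝓡)

@[simp] theorem pairing_tmul (f g : finiteDual k 𝓡) (x y : R) :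
    pairing k 𝓡 (f ⊗ₜ g) (x ⊗ₜ y) = (f : Module.Dual k R) x * (g : Module.Dual k R) y := by
  simp [pairing, TensorProduct.mapIncl]

theorem pairing_injective : Function.Injective (pairing k 𝓡) := by
  have h := TensorProduct.map_injective_of_flat_flat (R := k) (finiteDual k 𝓡).subtype
    (finiteDual k 𝓡).subtype (Submodule.subtype_injective _) (Submodule.subtype_injective _)
  exact (dualDistrib_injective k R R).comp h

/-- The functional `x ⊗ y ↦ f (x * y)` on `R ⊗ R` comes from `R° ⊗ R°`. -/
theorem exists_comul (f : finiteDual k 𝓡) :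
    (f : Module.Dual k R) ∘ₗ LinearMap.mul' k R ∈ LinearMap.range (pairing k 𝓡) := by
  obtain ⟨f, I, hI, hI3, hf⟩ := f
  have := hI.1
  let b := Module.finBasis k (R ⧸ I)
  choose r hr using fun i => Ideal.Quotient.mk_surjective (b i)
  let q : R →ₗ[k] R ⧸ I := I.mkQ.restrictScalars k
  let u : Fin (Module.finrank k (R ⧸ I)) → finiteDual k 𝓡 := fun i =>
    ⟨f ∘ₗ LinearMap.mulRight k (r i), I, hI, hI3, fun x hx => by
      simpa using hf _ (I.mul_mem_right (r i) hx)⟩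
  let v : Fin (Module.finrank k (R ⧸ I)) → finiteDual k 𝓡 := fun i =>
    ⟨b.coord i ∘ₗ q, I, hI, hI3, fun x hx => by
      have : q x = 0 := (Submodule.Quotient.mk_eq_zero I).2 hx
      rw [LinearMap.comp_apply, this, map_zero]⟩
  refine ⟨∑ i, u i ⊗ₜ v i, ?_⟩
  apply TensorProduct.ext'
  intro x y
  have hy : y - ∑ i, b.coord i (q y) • r i ∈ I := by
    rw [← Submodule.Quotient.mk_eq_zero I]
    change q _ = 0
    rw [map_sub, map_sum, sub_eq_zero]
    conv_lhs => rw [← b.sum_repr (q y)]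
    refine Finset.sum_congr rfl fun i _ => ?_
    rw [map_smul]
    have : q (r i) = b i := hr i
    rw [this]
    rfl
  have h := hf _ (I.mul_mem_left x hy)
  rw [mul_sub, map_sub, sub_eq_zero, Finset.mul_sum, map_sum] at h
  simp only [map_sum, LinearMap.sum_apply, pairing_tmul, LinearMap.comp_apply,
    LinearMap.mul'_apply]
  rw [h]
  refine Finset.sum_congr rfl fun i _ => ?_
  simp [u, v, mul_comm]

/-- The coproduct of `R°`, dual to the product of `R`. -/
def finiteDualComul : finiteDual k 𝓡 →ₗ[k] finiteDual k 𝓡 ⊗[k] finiteDual k 𝓡 :=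
  (LinearEquiv.ofInjective (pairing k 𝓡) (pairing_injective k 𝓡)).symm.toLinearMap ∘ₗ
    ((LinearMap.lcomp k k (LinearMap.mul' k R)) ∘ₗ (finiteDual k 𝓡).subtype).codRestrict
      (LinearMap.range (pairing k 𝓡)) (exists_comul k 𝓡)

theorem pairing_comul (f : finiteDual k 𝓡) (x y : R) :
    pairing k 𝓡 (finiteDualComul k 𝓡 f) (x ⊗ₜ y) = (f : Module.Dual k R) (x * y) := by
  have h : pairing k 𝓡 (finiteDualComul k 𝓡 f) =
      (f : Module.Dual k R) ∘ₗ LinearMap.mul' k R := by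
    have := (LinearEquiv.ofInjective (pairing k 𝓡) (pairing_injective k 𝓡)).apply_symm_apply
      (((LinearMap.lcomp k k (LinearMap.mul' k R)) ∘ₗ (finiteDual k 𝓡).subtype).codRestrict
      (LinearMap.range (pairing k 𝓡)) (exists_comul k 𝓡) f)
    exact congrArg Subtype.val this
  rw [h]
  simp

/-- The counit of `R°`: evaluation at `1`. -/
def finiteDualCounit : finiteDual k 𝓡 →ₗ[k] k :=
  LinearMap.applyₗ (1 : R) ∘ₗ (finiteDual k 𝓡).subtype

/-- The pairing of `R° ⊗ (R° ⊗ R°)` with `R ⊗ (R ⊗ R)`. -/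
def pairing₃ : finiteDual k 𝓡 ⊗[k] (finiteDual k 𝓡 ⊗[k] finiteDual k 𝓡) →ₗ[k]
    Module.Dual k (R ⊗[k] (R ⊗[k] R)) :=
  TensorProduct.dualDistrib k R (R ⊗[k] R) ∘ₗ
    TensorProduct.map (finiteDual k 𝓡).subtype (pairing k 𝓡)

theorem pairing₃_injective : Function.Injective (pairing₃ k 𝓡) := by
  have h := TensorProduct.map_injective_of_flat_flat (R := k) (finiteDual k 𝓡).subtype
    (pairing k 𝓡) (Submodule.subtype_injective _) (pairing_injective k 𝓡)
  exact (dualDistrib_injective k R (R ⊗[k] R)).comp h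

theorem pairing₃_lTensor (t : finiteDual k 𝓡 ⊗[k] finiteDual k 𝓡) (x y z : R) :
    pairing₃ k 𝓡 ((finiteDualComul k 𝓡).lTensor _ t) (x ⊗ₜ (y ⊗ₜ z)) =
      pairing k 𝓡 t (x ⊗ₜ (y * z)) := by
  induction t with
  | zero => simp
  | add s t hs ht => simp [hs, ht]
  | tmul f g => simp [pairing₃, pairing_comul]

theorem pairing₃_assoc (t : finiteDual k 𝓡 ⊗[k] finiteDual k 𝓡) (g : finiteDual k 𝓡)
    (x y z : R) :
    pairing₃ k 𝓡 (TensorProduct.assoc k _ _ _ (t ⊗ₜ g)) (x ⊗ₜ (y ⊗ₜ z)) =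
      pairing k 𝓡 t (x ⊗ₜ y) * (g : Module.Dual k R) z := by
  induction t with
  | zero => simp
  | add s t hs ht => simp [TensorProduct.add_tmul, hs, ht, add_mul]
  | tmul f h => simp [pairing₃, mul_assoc]

theorem pairing₃_rTensor (t : finiteDual k 𝓡 ⊗[k] finiteDual k 𝓡) (x y z : R) :
    pairing₃ k 𝓡 (TensorProduct.assoc k _ _ _ ((finiteDualComul k 𝓡).rTensor _ t))
      (x ⊗ₜ (y ⊗ₜ z)) = pairing k 𝓡 t ((x * y) ⊗ₜ z) := by
  induction t with
  | zero => simp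
  | add s t hs ht => simp [hs, ht]
  | tmul f g => simp [pairing₃_assoc, pairing_comul]

theorem lid_rTensor_counit (t : finiteDual k 𝓡 ⊗[k] finiteDual k 𝓡) (y : R) :
    (TensorProduct.lid k (finiteDual k 𝓡) ((finiteDualCounit k 𝓡).rTensor _ t) : Module.Dual k R) y =
      pairing k 𝓡 t (1 ⊗ₜ y) := by
  induction t with
  | zero => simp
  | add s t hs ht => simp [hs, ht]
  | tmul f g => simp [finiteDualCounit]

theorem rid_lTensor_counit (t : finiteDual k 𝓡 ⊗[k] finiteDual k 𝓡) (x : R) :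
    (TensorProduct.rid k (finiteDual k 𝓡) ((finiteDualCounit k 𝓡).lTensor _ t) : Module.Dual k R) x =
      pairing k 𝓡 t (x ⊗ₜ 1) := by
  induction t with
  | zero => simp
  | add s t hs ht => simp [hs, ht]
  | tmul f g => simp [finiteDualCounit, mul_comm]

instance : Coalgebra k (finiteDual k 𝓡) where
  comul := finiteDualComul k 𝓡
  counit := finiteDualCounit k 𝓡
  coassoc := by
    refine LinearMap.ext fun f => pairing₃_injective k 𝓡 ?_
    refine TensorProduct.ext' fun x w => ?_
    induction w with
    | zero => simp
    | add s t hs ht => simp only [TensorProduct.tmul_add, map_add, hs, ht]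
    | tmul y z =>
      simp only [LinearMap.comp_apply, LinearEquiv.coe_coe]
      rw [pairing₃_rTensor, pairing₃_lTensor, pairing_comul, pairing_comul, mul_assoc]
  rTensor_counit_comp_comul := by
    refine LinearMap.ext fun f => (TensorProduct.lid k _).injective (Subtype.ext ?_)
    refine LinearMap.ext fun y => ?_
    rw [LinearMap.comp_apply, lid_rTensor_counit, pairing_comul]
    simp
  lTensor_counit_comp_comul := by
    refine LinearMap.ext fun f => (TensorProduct.rid k _).injective (Subtype.ext ?_)
    refine LinearMap.ext fun x => ?_
    rw [LinearMap.comp_apply, rid_lTensor_counit, pairing_comul]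
    simp

theorem finiteDualProj_mem (i : ZMod 2) (f : finiteDual k 𝓡) :
    finiteDualProj k 𝓡 i f ∈ finiteDualGrading k 𝓡 i := by
  intro j hj x hx
  simp [finiteDualProj, proj_of_mem_ne 𝓡 hj hx]

theorem sum_finiteDualProj :
    ∑ i : ZMod 2, finiteDualProj k 𝓡 i = LinearMap.id := by
  ext f x
  simp only [LinearMap.sum_apply, LinearMap.id_apply]
  conv_rhs => rw [← sum_proj (k := k) 𝓡 x, map_sum]
  simp [finiteDualProj]

theorem pairing_map_proj (i j : ZMod 2) (t : finiteDual k 𝓡 ⊗[k] finiteDual k 𝓡) (x y : R) :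
    pairing k 𝓡 (TensorProduct.map (finiteDualProj k 𝓡 i) (finiteDualProj k 𝓡 j) t) (x ⊗ₜ y) =
      pairing k 𝓡 t (proj k 𝓡 i x ⊗ₜ proj k 𝓡 j y) := by
  induction t with
  | zero => simp
  | add s t hs ht => simp [hs, ht]
  | tmul f g => simp [finiteDualProj]

/-- `R°` is a super-coalgebra. -/
instance : IsSuperCoalgebra k (finiteDualGrading k 𝓡) where
  comul_mem := by
    intro n f hf
    change finiteDualComul k 𝓡 f ∈ _
    have hsum : finiteDualComul k 𝓡 f = ∑ i : ZMod 2, ∑ j : ZMod 2,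
        TensorProduct.map (finiteDualProj k 𝓡 i) (finiteDualProj k 𝓡 j)
          (finiteDualComul k 𝓡 f) := by
      have h : TensorProduct.map (∑ i : ZMod 2, finiteDualProj k 𝓡 i)
          (∑ j : ZMod 2, finiteDualProj k 𝓡 j) (finiteDualComul k 𝓡 f) =
          finiteDualComul k 𝓡 f := by
        rw [sum_finiteDualProj, TensorProduct.map_id, LinearMap.id_apply]
      conv_lhs => rw [← h]
      rw [← TensorProduct.mapBilinear_apply]
      simp only [map_sum, LinearMap.sum_apply, TensorProduct.mapBilinear_apply]
      exact Finset.sum_comm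
    rw [hsum]
    refine Submodule.sum_mem _ fun i _ => Submodule.sum_mem _ fun j _ => ?_
    by_cases hij : j = n - i
    · subst hij
      refine Submodule.mem_iSup_of_mem i ?_
      generalize finiteDualComul k 𝓡 f = t
      induction t with
      | zero => simp
      | add s t hs ht => rw [map_add]; exact Submodule.add_mem _ hs ht
      | tmul g h =>
        exact ⟨⟨_, finiteDualProj_mem k 𝓡 i g⟩ ⊗ₜ ⟨_, finiteDualProj_mem k 𝓡 (n - i) h⟩, by
          simp [TensorProduct.mapIncl]⟩
    · have h0 : TensorProduct.map (finiteDualProj k 𝓡 i) (finiteDualProj k 𝓡 j)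
          (finiteDualComul k 𝓡 f) = 0 := by
        apply pairing_injective k 𝓡
        rw [map_zero]
        apply TensorProduct.ext'
        intro x y
        rw [pairing_map_proj, pairing_comul]
        refine hf (i + j) (fun h => hij ?_) _
          (SetLike.mul_mem_graded (proj_mem 𝓡 i x) (proj_mem 𝓡 j y))
        rw [← h]
        ring
      rw [h0]
      exact Submodule.zero_mem _
  counit_eq_zero := by
    intro f hf
    exact hf 0 (by decide) 1 (SetLike.GradedOne.one_mem)

end FiniteDual

/-- `A` is reflexive: the canonical map `a ↦ (f ↦ f a)` is an isomorphism of super-coalgebras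
from `A` onto `(A*)°`. -/
def IsReflexive (k : Type*) [Field k] {A : Type*} [AddCommGroup A] [Module k A] [Coalgebra k A]
    (𝒜 : ZMod 2 → Submodule k A) [DirectSum.Decomposition 𝒜] [IsSuperCoalgebra k 𝒜] : Prop :=
  ∃ e : A ≃ₗc[k] finiteDual k (dualGrading k 𝒜),
    (∀ i, ∀ a ∈ 𝒜 i, e a ∈ finiteDualGrading k (dualGrading k 𝒜) i) ∧
    ∀ (a : A) (f : WithConv (A →ₗ[k] k)),
      (e a : Module.Dual k (WithConv (A →ₗ[k] k))) f = f.ofConv a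

end SuperCoalg

end

noncomputable section

set_option linter.unusedSectionVars false

namespace SuperCoalg

/-! ### The coalgebra as a module over its dual algebra -/

section Action

variable {k : Type*} [Field k] {A : Type*} [AddCommGroup A] [Module k A]

/-! The argument takes place over the dual superalgebra `A*`, which acts on `A` from the left by `f
• a = ∑ f(a₂) a₁`. Super-cocommutativity makes `A*` supercommutative: homogeneous functionals are
normal, even ones are central, and odd ones square to zero because the characteristic is not 2.
Sub-super-coalgebras are exactly the graded submodules (`isSubSuperCoalgebra_iff`), and the wedge of
`X` and `Y` consists of the `a` that the annihilator of `Y` sends into `X` (`mem_wedge_iff`). Let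
`C` be the coradical and `J` its annihilator in `A*`. Then `A_n` is the set of elements killed by
all products of `n + 1` elements of `J`, and these terms exhaust `A` (`exists_mem_filt`), since
homogeneous elements of `J` are nilpotent on finite-dimensional graded submodules.

Suppose that `A_1` is finite-dimensional. Then a finite homogeneous set `G` in `J` spans `J` modulo
the annihilator of `A_1`, and membership in a term of the filtration can be tested on `G` alone
(`Generates.mem_filt_of_mem`, dual to Nakayama's lemma). Hence `G` maps `A_(n+1)` to a power of
`A_n` with kernel inside `A_n`, so every `A_n` is finite-dimensional; local finiteness follows, as a
wedge of two terms lies in a later term. For reflexivity, `J` lies in the Jacobson radical, so a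
superideal of finite codimension contains the annihilator of some `A_n` (`exists_perp_filt_le`), and
a finite-dimensional space is its own bidual. For the Noetherian property, the elements killed by
`G` form a finite-dimensional space; dropping the odd members of `G` keeps it finite-dimensional
because they square to zero, and the even members are central and locally nilpotent, so the power
series form of Hilbert's basis argument applies (`FGModPerp.of_inf_ker`). This bounds all left
ideals, not only superideals.

Conversely, `A_1` is the wedge of `A_0` with itself, so local finiteness bounds it. Reflexivity
makes `A_1` its own bidual, which forces finite dimension. Taking annihilators turns the ascending
condition on superideals into the descending condition on sub-super-coalgebras. That condition makes
`A` an Artinian module (`isArtinian_of_dcc`); then `C` is semisimple Artinian, hence finitely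
generated, hence finite-dimensional, and the Hopkins–Levitzki argument over the finite-dimensional
algebra `A*/J` carries this over to `A_1`. -/

theorem eq_of_forall_dual {a b : A} (h : ∀ f : WithConv (A →ₗ[k] k), f.ofConv a = f.ofConv b) :
    a = b := by
  rw [← sub_eq_zero, ← Module.forall_dual_apply_eq_zero_iff k]
  intro f
  simpa [sub_eq_zero] using h (WithConv.toConv f)

theorem exists_dual_of_notMem {V : Submodule k A} {a : A} (h : a ∉ V) :
    ∃ f : WithConv (A →ₗ[k] k), (∀ b ∈ V, f.ofConv b = 0) ∧ f.ofConv a ≠ 0 := by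
  obtain ⟨f, hf, hV⟩ := Submodule.exists_le_ker_of_notMem h
  exact ⟨WithConv.toConv f, fun b hb => hV hb, hf⟩

theorem mem_of_forall_dual {V : Submodule k A} {a : A}
    (h : ∀ f : WithConv (A →ₗ[k] k), (∀ b ∈ V, f.ofConv b = 0) → f.ofConv a = 0) : a ∈ V := by
  by_contra ha
  obtain ⟨f, hV, hf⟩ := exists_dual_of_notMem ha
  exact hf (h f hV)

/-- Elements of a tensor product are separated by tensor products of functionals. -/
theorem tensor_eq_zero_of_forall {M N : Type*} [AddCommGroup M] [Module k M] [AddCommGroup N]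
    [Module k N] {t : M ⊗[k] N}
    (h : ∀ (f : M →ₗ[k] k) (g : N →ₗ[k] k),
      LinearMap.mul' k k (TensorProduct.map f g t) = 0) : t = 0 := by
  let b := Module.Basis.ofVectorSpace k M
  let c := Module.Basis.ofVectorSpace k N
  apply (b.tensorProduct c).repr.injective
  rw [map_zero]
  ext ⟨i, j⟩
  have key : ∀ s : M ⊗[k] N, (b.tensorProduct c).repr s (i, j) =
      LinearMap.mul' k k (TensorProduct.map (b.coord i) (c.coord j) s) := by
    intro s
    induction s with
    | zero => simp
    | add x y hx hy => simp [hx, hy]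
    | tmul x y => simp [mul_comm]
  rw [key, h]
  rfl

variable [Coalgebra k A]

/-- The action of the dual algebra on a coalgebra: `f • a = ∑ f(a₂) a₁`. -/
def dualAct : WithConv (A →ₗ[k] k) →ₗ[k] A →ₗ[k] A where
  toFun f := (TensorProduct.rid k A).toLinearMap ∘ₗ f.ofConv.lTensor A ∘ₗ Coalgebra.comul
  map_add' f g := by
    ext a
    simp [LinearMap.lTensor_add]
  map_smul' c f := by
    ext a
    simp [LinearMap.lTensor_smul]

/-- Acting on `A` is adjoint to right multiplication on `A*`, so identities for the action can be
checked in `A*` by testing against functionals. -/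
theorem dual_dualAct (f g : WithConv (A →ₗ[k] k)) (a : A) :
    g.ofConv (dualAct f a) = (g * f).ofConv a := by
  rw [LinearMap.convMul_apply]
  change g.ofConv (TensorProduct.rid k A (f.ofConv.lTensor A (Coalgebra.comul a))) = _
  generalize (Coalgebra.comul a : A ⊗[k] A) = t
  induction t with
  | zero => simp
  | add x y hx hy => simp only [map_add, hx, hy]
  | tmul x y => simp [mul_comm]

instance dualModule : Module (WithConv (A →ₗ[k] k)) A where
  smul f a := dualAct f a
  one_smul a := eq_of_forall_dual (k := k) fun g => by
    change g.ofConv (dualAct 1 a) = _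
    rw [dual_dualAct, mul_one]
  mul_smul f g a := eq_of_forall_dual (k := k) fun h => by
    change h.ofConv (dualAct (f * g) a) = h.ofConv (dualAct f (dualAct g a))
    rw [dual_dualAct, dual_dualAct, dual_dualAct, mul_assoc]
  smul_zero f := map_zero (dualAct f)
  smul_add f := map_add (dualAct f)
  add_smul f g a := by
    change dualAct (f + g) a = dualAct f a + dualAct g a
    rw [map_add, LinearMap.add_apply]
  zero_smul a := by
    change dualAct (0 : WithConv (A →ₗ[k] k)) a = 0
    rw [map_zero, LinearMap.zero_apply]

theorem dualAct_apply (f : WithConv (A →ₗ[k] k)) (a : A) : dualAct f a = f • a := rfl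

theorem dual_smul (f g : WithConv (A →ₗ[k] k)) (a : A) :
    g.ofConv (f • a) = (g * f).ofConv a :=
  dual_dualAct f g a

instance : IsScalarTower k (WithConv (A →ₗ[k] k)) A where
  smul_assoc c f a := by
    change dualAct (c • f) a = c • dualAct f a
    rw [map_smul, LinearMap.smul_apply]

instance : SMulCommClass k (WithConv (A →ₗ[k] k)) A where
  smul_comm c f a := (map_smul (dualAct f) c a).symm

theorem dual_one (a : A) : (1 : WithConv (A →ₗ[k] k)).ofConv a = Coalgebra.counit (R := k) a := by
  simp [LinearMap.convOne_def]

/-- Shows that a functional killing `a` under the action also vanishes at `a`. -/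
theorem dual_eq_counit_smul (f : WithConv (A →ₗ[k] k)) (a : A) :
    f.ofConv a = Coalgebra.counit (R := k) (f • a) := by
  rw [← dual_one, dual_smul, one_mul]

/-- An element of `A/X ⊗ A/Y` is zero once all products of a functional killing `X` and one killing
`Y` vanish on it; on `Δ(a)` such a product has the value `f(g • a)`. -/
theorem mem_wedge_iff {X Y : Submodule k A} {a : A} :
    a ∈ wedge k X Y ↔ ∀ g : WithConv (A →ₗ[k] k), (∀ y ∈ Y, g.ofConv y = 0) → g • a ∈ X := by
  have key : ∀ (f g : A →ₗ[k] k) (hf : X ≤ LinearMap.ker f) (hg : Y ≤ LinearMap.ker g),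
      LinearMap.mul' k k (TensorProduct.map (X.liftQ f hf) (Y.liftQ g hg)
        (TensorProduct.map X.mkQ Y.mkQ (Coalgebra.comul (R := k) a))) =
      (WithConv.toConv f * WithConv.toConv g).ofConv a := by
    intro f g hf hg
    rw [LinearMap.convMul_apply, ← LinearMap.comp_apply (TensorProduct.map _ _),
      ← TensorProduct.map_comp, Submodule.liftQ_mkQ, Submodule.liftQ_mkQ]
  constructor
  · intro ha g hg
    refine mem_of_forall_dual fun f hf => ?_
    have h := key f.ofConv g.ofConv hf hg
    have ha' : TensorProduct.map X.mkQ Y.mkQ (Coalgebra.comul (R := k) a) = 0 := ha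
    rw [ha', map_zero, map_zero] at h
    rw [dual_smul]
    exact h.symm
  · intro h
    change TensorProduct.map X.mkQ Y.mkQ (Coalgebra.comul (R := k) a) = 0
    refine tensor_eq_zero_of_forall fun f g => ?_
    have hf : X ≤ LinearMap.ker (f ∘ₗ X.mkQ) := fun x hx => by
      simp [(Submodule.Quotient.mk_eq_zero X).2 hx]
    have hg : Y ≤ LinearMap.ker (g ∘ₗ Y.mkQ) := fun x hx => by
      simp [(Submodule.Quotient.mk_eq_zero Y).2 hx]
    have hk := key _ _ hf hg
    have h1 : X.liftQ (f ∘ₗ X.mkQ) hf = f := by ext; simp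
    have h2 : Y.liftQ (g ∘ₗ Y.mkQ) hg = g := by ext; simp
    rw [h1, h2] at hk
    rw [hk, ← dual_smul]
    exact hf (h _ hg)

/-- A criterion for `Δ(b) ∈ B ⊗ B` in terms of functionals. -/
theorem comul_mem_range_mapIncl {B : Submodule k A} {b : A}
    (hl : ∀ f : WithConv (A →ₗ[k] k), f • b ∈ B)
    (hr : ∀ f g : WithConv (A →ₗ[k] k), (∀ x ∈ B, g.ofConv x = 0) → (f * g).ofConv b = 0) :
    Coalgebra.comul (R := k) b ∈ LinearMap.range (TensorProduct.mapIncl B B) := by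
  obtain ⟨P, hP⟩ := LinearMap.exists_leftInverse_of_injective B.subtype
    (Submodule.ker_subtype B)
  have hPB : ∀ x ∈ B, (P x : A) = x := fun x hx =>
    congrArg Subtype.val (LinearMap.congr_fun hP ⟨x, hx⟩)
  -- `Q` projects `A` onto `B`, and the aim is `(Q ⊗ Q)Δ(b) = Δ(b)`. On the left factor `f ∘ Q` may
  -- replace `f` because `f` is evaluated at an element of `B` (`hl`); on the right factor `g ∘ Q -
  -- g` vanishes on `B` (`hr`).
  let Q : A →ₗ[k] A := B.subtype ∘ₗ P
  have hQ : ∀ x ∈ B, Q x = x := hPB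
  have e1 : ∀ f g : A →ₗ[k] k, ∀ s : A ⊗[k] A,
      LinearMap.mul' k k (TensorProduct.map f g (TensorProduct.map Q Q s)) =
      LinearMap.mul' k k (TensorProduct.map (f ∘ₗ Q) (g ∘ₗ Q) s) := by
    intro f g s
    rw [← LinearMap.comp_apply (TensorProduct.map f g), ← TensorProduct.map_comp]
  have h : TensorProduct.map Q Q (Coalgebra.comul (R := k) b) = Coalgebra.comul (R := k) b := by
    rw [← sub_eq_zero]
    refine tensor_eq_zero_of_forall fun f g => ?_
    rw [map_sub, map_sub, e1, sub_eq_zero]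
    have c1 := LinearMap.convMul_apply (WithConv.toConv (f ∘ₗ Q)) (WithConv.toConv (g ∘ₗ Q)) b
    have c2 := LinearMap.convMul_apply (WithConv.toConv f) (WithConv.toConv g) b
    dsimp only at c1 c2
    rw [← c1, ← c2]
    have s1 : (WithConv.toConv (f ∘ₗ Q) * WithConv.toConv (g ∘ₗ Q)).ofConv b =
        (WithConv.toConv f * WithConv.toConv (g ∘ₗ Q)).ofConv b := by
      rw [← dual_smul, ← dual_smul]
      change f (Q _) = f _
      rw [hQ _ (hl _)]
    rw [s1, ← sub_eq_zero, ← LinearMap.sub_apply, ← WithConv.ofConv_sub, ← mul_sub]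
    refine hr _ _ fun x hx => ?_
    change g (Q x) - g x = 0
    rw [hQ x hx, sub_self]
  refine ⟨TensorProduct.map P P (Coalgebra.comul (R := k) b), ?_⟩
  rw [TensorProduct.mapIncl, ← LinearMap.comp_apply, ← TensorProduct.map_comp]
  exact h

theorem smul_mem_of_comul_mem {B : Submodule k A} {b : A}
    (hb : Coalgebra.comul (R := k) b ∈ LinearMap.range (TensorProduct.mapIncl B B))
    (f : WithConv (A →ₗ[k] k)) : f • b ∈ B := by
  obtain ⟨t, ht⟩ := hb
  change TensorProduct.rid k A (f.ofConv.lTensor A (Coalgebra.comul b)) ∈ B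
  rw [← ht]
  clear ht
  induction t with
  | zero => simp
  | add x y hx hy => simpa only [map_add] using B.add_mem hx hy
  | tmul x y => simpa [TensorProduct.mapIncl] using B.smul_mem _ x.2

/-- The orbit of an element under the dual algebra is finite-dimensional. -/
theorem finiteDimensional_orbit (a : A) :
    FiniteDimensional k (Submodule.span (WithConv (A →ₗ[k] k)) {a} |>.restrictScalars k) := by
  obtain ⟨S, hS⟩ := TensorProduct.exists_finset (Coalgebra.comul (R := k) a)
  classical
  let U : Submodule k A := Submodule.span k (S.image Prod.fst : Finset A)
  have : FiniteDimensional k U := FiniteDimensional.span_finset k _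
  have hle : (Submodule.span (WithConv (A →ₗ[k] k)) {a}).restrictScalars k ≤ U := by
    intro x hx
    obtain ⟨f, rfl⟩ := Submodule.mem_span_singleton.1 (show x ∈ Submodule.span _ {a} from hx)
    change TensorProduct.rid k A (f.ofConv.lTensor A (Coalgebra.comul a)) ∈ U
    rw [hS, map_sum, map_sum]
    refine Submodule.sum_mem _ fun p hp => ?_
    rw [LinearMap.lTensor_tmul, TensorProduct.rid_tmul]
    exact U.smul_mem _ (Submodule.subset_span (Finset.mem_coe.2 (Finset.mem_image_of_mem _ hp)))
  exact Submodule.finiteDimensional_of_le hle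

end Action

/-! ### Parity, supercommutativity of the dual, and graded submodules -/

section Grading

variable {k : Type*} [Field k] {A : Type*} [AddCommGroup A] [Module k A]
  (𝒜 : ZMod 2 → Submodule k A) [DirectSum.Decomposition 𝒜]

theorem dual_proj_apply (i : ZMod 2) (f : WithConv (A →ₗ[k] k)) (a : A) :
    (proj k (dualGrading k 𝒜) i f).ofConv a = f.ofConv (proj k 𝒜 i a) := by
  let q : ZMod 2 → WithConv (A →ₗ[k] k) := fun j => WithConv.toConv (f.ofConv ∘ₗ proj k 𝒜 j)
  have hq : ∀ j, q j ∈ dualGrading k 𝒜 j := by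
    intro j m hm a ha
    simp [q, proj_of_mem_ne 𝒜 hm ha]
  have hf : f = ∑ j, q j := by
    apply WithConv.ext
    ext a
    rw [WithConv.ofConv_sum, LinearMap.sum_apply]
    conv_lhs => rw [← sum_proj (k := k) 𝒜 a, map_sum]
    simp [q]
  have : proj k (dualGrading k 𝒜) i f = q i := by
    conv_lhs => rw [hf, map_sum]
    rw [Finset.sum_eq_single i, proj_of_mem _ (hq i)]
    · intro j _ hj
      exact proj_of_mem_ne _ hj (hq j)
    · simp
  rw [this]
  rfl

theorem mem_grading_of_forall_dual {n : ZMod 2} {b : A}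
    (h : ∀ m, m ≠ n → ∀ g ∈ dualGrading k 𝒜 m, g.ofConv b = 0) : b ∈ 𝒜 n := by
  rw [← sum_proj (k := k) 𝒜 b]
  refine Submodule.sum_mem _ fun m _ => ?_
  by_cases hm : m = n
  · subst hm
    exact proj_mem 𝒜 m b
  · have : proj k 𝒜 m b = 0 := eq_of_forall_dual (k := k) fun g => by
      rw [← dual_proj_apply, map_zero]
      exact h m hm _ (proj_mem _ m g)
    rw [this]
    exact Submodule.zero_mem _

/-- A subset of a super vector space closed under the projections to the components. -/
def IsGraded (V : Set A) : Prop :=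
  ∀ i, ∀ a ∈ V, proj k 𝒜 i a ∈ V

variable {𝒜}

theorem isGraded_iff_isHomogeneous {V : Submodule k A} :
    IsGraded 𝒜 (V : Set A) ↔ V.IsHomogeneous 𝒜 :=
  ⟨fun h i _ ha => h i _ ha, fun h i _ ha => h i ha⟩

theorem IsGraded.proj_perp {V : Set A} (hV : IsGraded 𝒜 V) {f : WithConv (A →ₗ[k] k)}
    (hf : ∀ a ∈ V, f.ofConv a = 0) (i : ZMod 2) :
    ∀ a ∈ V, (proj k (dualGrading k 𝒜) i f).ofConv a = 0 := fun a ha => by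
  rw [dual_proj_apply]
  exact hf _ (hV i a ha)

variable [Coalgebra k A] [IsSuperCoalgebra k 𝒜]

theorem smul_mem_grading {i j : ZMod 2} {a : A} (ha : a ∈ 𝒜 i) {f : WithConv (A →ₗ[k] k)}
    (hf : f ∈ dualGrading k 𝒜 j) : f • a ∈ 𝒜 (i - j) := by
  refine mem_grading_of_forall_dual 𝒜 fun m hm g hg => ?_
  rw [dual_smul]
  refine SetLike.mul_mem_graded hg hf i (fun h => hm ?_) a ha
  rw [h]
  ring

theorem proj_smul_of_mem {j : ZMod 2} {f : WithConv (A →ₗ[k] k)} (hf : f ∈ dualGrading k 𝒜 j)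
    (n : ZMod 2) (a : A) : proj k 𝒜 n (f • a) = f • proj k 𝒜 (n + j) a := by
  conv_lhs => rw [← sum_proj (k := k) 𝒜 a, Finset.smul_sum, map_sum]
  rw [Finset.sum_eq_single (n + j)]
  · rw [proj_of_mem]
    simpa using smul_mem_grading (proj_mem 𝒜 (n + j) a) hf
  · intro m _ hm
    refine proj_of_mem_ne 𝒜 (fun h => hm ?_) (smul_mem_grading (proj_mem 𝒜 m a) hf)
    rw [← h]
    ring
  · simp

theorem smul_eq_sum_proj (f : WithConv (A →ₗ[k] k)) (a : A) :
    f • a = ∑ j, proj k (dualGrading k 𝒜) j f • a := by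
  rw [← Finset.sum_smul, sum_proj]

theorem proj_smul (f : WithConv (A →ₗ[k] k)) (n : ZMod 2) (a : A) :
    proj k 𝒜 n (f • a) = ∑ j, proj k (dualGrading k 𝒜) j f • proj k 𝒜 (n + j) a := by
  rw [smul_eq_sum_proj (𝒜 := 𝒜), map_sum]
  exact Finset.sum_congr rfl fun j _ => proj_smul_of_mem (proj_mem _ j f) n a

/-- The dual of a super-cocommutative super-coalgebra is supercommutative. -/
theorem dual_mul_comm (hA : IsSuperCocommutative k 𝒜) {i j : ZMod 2}
    {f g : WithConv (A →ₗ[k] k)} (hf : f ∈ dualGrading k 𝒜 i) (hg : g ∈ dualGrading k 𝒜 j) :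
    g * f = ((-1 : k) ^ (i.val * j.val)) • (f * g) := by
  have eval : ∀ {i : ZMod 2} {f : WithConv (A →ₗ[k] k)}, f ∈ dualGrading k 𝒜 i → ∀ p v,
      f.ofConv (proj k 𝒜 p v) = if p = i then f.ofConv v else 0 := by
    intro i f hf p v
    split_ifs with h
    · subst h
      rw [← dual_proj_apply, proj_of_mem _ hf]
    · exact hf p h _ (proj_mem 𝒜 p v)
  have key : ∀ t : A ⊗[k] A,
      LinearMap.mul' k k (TensorProduct.map g.ofConv f.ofConv (superTwist k 𝒜 t)) =
      ((-1 : k) ^ (i.val * j.val)) * LinearMap.mul' k k (TensorProduct.map f.ofConv g.ofConv t) := by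
    intro t
    induction t with
    | zero => simp
    | add x y hx hy => simp only [map_add, hx, hy, mul_add]
    | tmul v w =>
      simp only [superTwist, LinearMap.sum_apply, LinearMap.smul_apply, LinearMap.comp_apply,
        TensorProduct.map_tmul, LinearEquiv.coe_coe, TensorProduct.comm_tmul, map_sum, map_smul,
        LinearMap.mul'_apply, eval hf, eval hg]
      simp [mul_comm]
  apply WithConv.ext
  ext a
  rw [WithConv.ofConv_smul, LinearMap.smul_apply, LinearMap.convMul_apply,
    LinearMap.convMul_apply, smul_eq_mul, ← key]
  congr 2
  exact (LinearMap.congr_fun hA a).symm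

/-- Homogeneous elements of the dual are normal. -/
theorem exists_mul_eq_mul_left (hA : IsSuperCocommutative k 𝒜) {j : ZMod 2}
    {f : WithConv (A →ₗ[k] k)} (hf : f ∈ dualGrading k 𝒜 j) (u : WithConv (A →ₗ[k] k)) :
    ∃ u' : WithConv (A →ₗ[k] k), f * u = u' * f ∧
      ∀ V : Set A, IsGraded 𝒜 V → (∀ a ∈ V, u.ofConv a = 0) → ∀ a ∈ V, u'.ofConv a = 0 := by
  refine ⟨∑ i, ((-1 : k) ^ (i.val * j.val)) • proj k (dualGrading k 𝒜) i u, ?_, ?_⟩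
  · conv_lhs => rw [← sum_proj (k := k) (dualGrading k 𝒜) u, Finset.mul_sum]
    rw [Finset.sum_mul]
    refine Finset.sum_congr rfl fun i _ => ?_
    rw [dual_mul_comm hA (proj_mem _ i u) hf, smul_mul_assoc]
  · intro V hV hu a ha
    rw [WithConv.ofConv_sum, LinearMap.sum_apply]
    refine Finset.sum_eq_zero fun i _ => ?_
    rw [WithConv.ofConv_smul, LinearMap.smul_apply, hV.proj_perp hu i a ha, smul_zero]

theorem exists_mul_eq_mul_right (hA : IsSuperCocommutative k 𝒜) {j : ZMod 2}
    {f : WithConv (A →ₗ[k] k)} (hf : f ∈ dualGrading k 𝒜 j) (u : WithConv (A →ₗ[k] k)) :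
    ∃ u' : WithConv (A →ₗ[k] k), u * f = f * u' := by
  refine ⟨∑ i, ((-1 : k) ^ (j.val * i.val)) • proj k (dualGrading k 𝒜) i u, ?_⟩
  conv_lhs => rw [← sum_proj (k := k) (dualGrading k 𝒜) u, Finset.sum_mul]
  rw [Finset.mul_sum]
  refine Finset.sum_congr rfl fun i _ => ?_
  rw [dual_mul_comm hA hf (proj_mem _ i u), mul_smul_comm]

theorem mul_comm_of_even (hA : IsSuperCocommutative k 𝒜)
    {f : WithConv (A →ₗ[k] k)} (hf : f ∈ dualGrading k 𝒜 0) (u : WithConv (A →ₗ[k] k)) :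
    u * f = f * u := by
  conv_lhs => rw [← sum_proj (k := k) (dualGrading k 𝒜) u, Finset.sum_mul]
  conv_rhs => rw [← sum_proj (k := k) (dualGrading k 𝒜) u, Finset.mul_sum]
  refine Finset.sum_congr rfl fun i _ => ?_
  rw [dual_mul_comm hA hf (proj_mem _ i u)]
  simp

/-- Supercommutativity gives `f * f = -(f * f)`; it remains to divide by 2. -/
theorem mul_self_of_odd (hk : ringChar k ≠ 2) (hA : IsSuperCocommutative k 𝒜)
    {f : WithConv (A →ₗ[k] k)} (hf : f ∈ dualGrading k 𝒜 1) : f * f = 0 := by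
  have h := dual_mul_comm hA hf hf
  have h1 : ((-1 : k) ^ ((1 : ZMod 2).val * (1 : ZMod 2).val)) = -1 := by
    simp [ZMod.val_one]
  rw [h1, neg_one_smul, eq_neg_iff_add_eq_zero, ← two_smul k] at h
  exact (smul_eq_zero.1 h).resolve_left (Ring.two_ne_zero hk)

/-- The annihilator in the dual of a graded submodule is a two-sided ideal. -/
theorem perp_mul_left (hA : IsSuperCocommutative k 𝒜)
    {V : Submodule (WithConv (A →ₗ[k] k)) A} (hV : IsGraded 𝒜 (V : Set A))
    {f : WithConv (A →ₗ[k] k)} (hf : ∀ a ∈ V, f.ofConv a = 0) (u : WithConv (A →ₗ[k] k)) :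
    ∀ a ∈ V, (u * f).ofConv a = 0 := by
  intro a ha
  rw [← sum_proj (k := k) (dualGrading k 𝒜) f, Finset.mul_sum, WithConv.ofConv_sum,
    LinearMap.sum_apply]
  refine Finset.sum_eq_zero fun i _ => ?_
  obtain ⟨u', hu'⟩ := exists_mul_eq_mul_right hA (proj_mem (dualGrading k 𝒜) i f) u
  rw [hu', ← dual_smul]
  exact hV.proj_perp hf i _ (V.smul_mem _ ha)

theorem perp_mul_right {V : Submodule (WithConv (A →ₗ[k] k)) A}
    {f : WithConv (A →ₗ[k] k)} (hf : ∀ a ∈ V, f.ofConv a = 0) (u : WithConv (A →ₗ[k] k)) :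
    ∀ a ∈ V, (f * u).ofConv a = 0 := by
  intro a ha
  rw [← dual_smul]
  exact hf _ (V.smul_mem _ ha)

/-- The annihilator of `V` is a left ideal, so every functional `u` satisfies `u(f • a) = (u * f)(a)
= 0`. -/
theorem perp_smul (hA : IsSuperCocommutative k 𝒜)
    {V : Submodule (WithConv (A →ₗ[k] k)) A} (hV : IsGraded 𝒜 (V : Set A))
    {f : WithConv (A →ₗ[k] k)} (hf : ∀ a ∈ V, f.ofConv a = 0) {a : A} (ha : a ∈ V) :
    f • a = 0 :=
  eq_of_forall_dual (k := k) fun u => by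
    rw [dual_smul, perp_mul_left hA hV hf u a ha, map_zero]

/-- A submodule only satisfies `Δ(V) ⊆ V ⊗ A`. If it is graded, its annihilator is also a left
ideal, which puts the second tensor factor in `V` as well. -/
theorem isSubSuperCoalgebra_iff (hA : IsSuperCocommutative k 𝒜)
    {V : Submodule (WithConv (A →ₗ[k] k)) A} :
    IsSubSuperCoalgebra k 𝒜 (V.restrictScalars k) ↔ IsGraded 𝒜 (V : Set A) := by
  constructor
  · rintro ⟨h, -⟩
    exact isGraded_iff_isHomogeneous.2 h
  · intro h
    refine ⟨isGraded_iff_isHomogeneous.1 h, fun b hb => ?_⟩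
    refine comul_mem_range_mapIncl (fun f => V.smul_mem f hb) fun f g hg => ?_
    exact perp_mul_left hA h hg f b hb

theorem IsSubSuperCoalgebra.exists_submodule {B : Submodule k A}
    (hB : IsSubSuperCoalgebra k 𝒜 B) :
    ∃ V : Submodule (WithConv (A →ₗ[k] k)) A, V.restrictScalars k = B ∧
      IsGraded 𝒜 (V : Set A) := by
  let V : Submodule (WithConv (A →ₗ[k] k)) A :=
    { carrier := B
      add_mem' := B.add_mem
      zero_mem' := B.zero_mem
      smul_mem' := fun f b hb => smul_mem_of_comul_mem (hB.2 b hb) f }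
  exact ⟨V, rfl, isGraded_iff_isHomogeneous.2 hB.1⟩

theorem IsGraded.mem_of_proj {V : Submodule (WithConv (A →ₗ[k] k)) A} {a : A}
    (h : ∀ i, proj k 𝒜 i a ∈ V) : a ∈ V := by
  rw [← sum_proj (k := k) 𝒜 a]
  exact V.sum_mem fun i _ => h i

theorem IsGraded.bot : IsGraded 𝒜 ((⊥ : Submodule (WithConv (A →ₗ[k] k)) A) : Set A) := by
  rintro i a ha
  have : a = 0 := ha
  simp [this]

theorem IsGraded.sup {V W : Submodule (WithConv (A →ₗ[k] k)) A} (hV : IsGraded 𝒜 (V : Set A))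
    (hW : IsGraded 𝒜 (W : Set A)) :
    IsGraded 𝒜 ((V ⊔ W : Submodule (WithConv (A →ₗ[k] k)) A) : Set A) := by
  intro i a ha
  obtain ⟨v, hv, w, hw, rfl⟩ := Submodule.mem_sup.1 ha
  rw [map_add]
  exact Submodule.add_mem_sup (hV i v hv) (hW i w hw)

theorem IsGraded.sSup {S : Set (Submodule (WithConv (A →ₗ[k] k)) A)}
    (hS : ∀ V ∈ S, IsGraded 𝒜 (V : Set A)) :
    IsGraded 𝒜 ((sSup S : Submodule (WithConv (A →ₗ[k] k)) A) : Set A) := by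
  intro i a ha
  rw [SetLike.mem_coe, sSup_eq_iSup'] at ha ⊢
  refine Submodule.iSup_induction _ (motive := fun x => proj k 𝒜 i x ∈ ⨆ V : S, V.1) ha ?_ ?_ ?_
  · exact fun V x hx => Submodule.mem_iSup_of_mem V (hS V.1 V.2 i x hx)
  · simp
  · intro x y hx hy
    rw [map_add]
    exact Submodule.add_mem _ hx hy

/-- The graded submodule generated by an element. -/
def gradedSpan (𝒜 : ZMod 2 → Submodule k A) [DirectSum.Decomposition 𝒜] (a : A) :
    Submodule (WithConv (A →ₗ[k] k)) A :=
  ⨆ i, Submodule.span (WithConv (A →ₗ[k] k)) {proj k 𝒜 i a}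

theorem mem_gradedSpan (a : A) : a ∈ gradedSpan 𝒜 a :=
  IsGraded.mem_of_proj (𝒜 := 𝒜) fun i =>
    Submodule.mem_iSup_of_mem i (Submodule.mem_span_singleton_self _)

theorem isGraded_gradedSpan (a : A) : IsGraded 𝒜 (gradedSpan 𝒜 a : Set A) := by
  refine IsGraded.sSup ?_
  rintro _ ⟨i, rfl⟩ n x hx
  obtain ⟨f, rfl⟩ := Submodule.mem_span_singleton.1 (show x ∈ Submodule.span _ _ from hx)
  rw [proj_smul]
  refine Submodule.sum_mem _ fun j _ => ?_
  by_cases h : i = n + j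
  · rw [← h, proj_of_mem 𝒜 (proj_mem 𝒜 i a)]
    exact Submodule.smul_mem _ _ (Submodule.mem_span_singleton_self _)
  · rw [proj_of_mem_ne 𝒜 h (proj_mem 𝒜 i a), smul_zero]
    exact Submodule.zero_mem _

theorem finiteDimensional_sup {V W : Submodule (WithConv (A →ₗ[k] k)) A}
    (hV : FiniteDimensional k (V.restrictScalars k))
    (hW : FiniteDimensional k (W.restrictScalars k)) :
    FiniteDimensional k ((V ⊔ W).restrictScalars k) := by
  rw [Submodule.restrictScalars_sup]
  infer_instance

theorem finiteDimensional_gradedSpan (a : A) :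
    FiniteDimensional k ((gradedSpan 𝒜 a).restrictScalars k) := by
  have h : gradedSpan 𝒜 a = Submodule.span (WithConv (A →ₗ[k] k)) {proj k 𝒜 0 a} ⊔
      Submodule.span (WithConv (A →ₗ[k] k)) {proj k 𝒜 1 a} := by
    refine le_antisymm (iSup_le fun i => ?_) (sup_le (le_iSup_of_le 0 le_rfl)
      (le_iSup_of_le 1 le_rfl))
    fin_cases i
    · exact le_sup_left
    · exact le_sup_right
  rw [h]
  exact finiteDimensional_sup (finiteDimensional_orbit _) (finiteDimensional_orbit _)

/-- The image of a graded submodule under a homogeneous element of the dual. -/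
theorem exists_smul_submodule (hA : IsSuperCocommutative k 𝒜) {j : ZMod 2}
    {f : WithConv (A →ₗ[k] k)} (hf : f ∈ dualGrading k 𝒜 j)
    (V : Submodule (WithConv (A →ₗ[k] k)) A) :
    ∃ W : Submodule (WithConv (A →ₗ[k] k)) A, (∀ x, x ∈ W ↔ ∃ v ∈ V, f • v = x) ∧ W ≤ V ∧
      (IsGraded 𝒜 (V : Set A) → IsGraded 𝒜 (W : Set A)) := by
  refine ⟨
    { carrier := {x | ∃ v ∈ V, f • v = x}
      add_mem' := ?_
      zero_mem' := ⟨0, V.zero_mem, smul_zero f⟩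
      smul_mem' := ?_ }, fun x => Iff.rfl, ?_, ?_⟩
  · rintro _ _ ⟨v, hv, rfl⟩ ⟨w, hw, rfl⟩
    exact ⟨v + w, V.add_mem hv hw, smul_add f v w⟩
  · rintro u _ ⟨v, hv, rfl⟩
    obtain ⟨u', hu'⟩ := exists_mul_eq_mul_right hA hf u
    exact ⟨u' • v, V.smul_mem _ hv, by rw [← mul_smul, ← mul_smul, hu']⟩
  · rintro _ ⟨v, hv, rfl⟩
    exact V.smul_mem _ hv
  · rintro hV i _ ⟨v, hv, rfl⟩
    exact ⟨_, hV _ v hv, (proj_smul_of_mem hf i v).symm⟩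

end Grading

/-! ### Restriction of functionals -/

section Restrict

variable {k : Type*} [Field k] {A : Type*} [AddCommGroup A] [Module k A]

/-- The restriction of functionals to a subspace. -/
def dualRestrict (V : Submodule k A) : WithConv (A →ₗ[k] k) →ₗ[k] Module.Dual k V :=
  LinearMap.lcomp k k V.subtype ∘ₗ (WithConv.linearEquiv k (A →ₗ[k] k)).toLinearMap

theorem dualRestrict_eq_zero_iff {V : Submodule k A} {f : WithConv (A →ₗ[k] k)} :
    dualRestrict V f = 0 ↔ ∀ v ∈ V, f.ofConv v = 0 :=
  ⟨fun h v hv => LinearMap.congr_fun h ⟨v, hv⟩, fun h => LinearMap.ext fun v => h v v.2⟩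

theorem dualRestrict_surjective (V : Submodule k A) : Function.Surjective (dualRestrict V) := by
  intro φ
  obtain ⟨f, hf⟩ := LinearMap.exists_extend φ
  exact ⟨WithConv.toConv f, hf⟩

end Restrict

/-! ### Wedge powers and finite generation of the annihilator -/

section Filtration

variable {k : Type*} [Field k] {A : Type*} [AddCommGroup A] [Module k A] [Coalgebra k A]

/-- The wedge powers of a submodule over the dual algebra. -/
def filt (C : Submodule (WithConv (A →ₗ[k] k)) A) : ℕ → Submodule (WithConv (A →ₗ[k] k)) A
  | 0 => ⊥
  | n + 1 =>
    { carrier := {a | ∀ g : WithConv (A →ₗ[k] k), (∀ c ∈ C, g.ofConv c = 0) → g • a ∈ filt C n}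
      add_mem' := fun {a b} ha hb g hg => by
        rw [smul_add]
        exact Submodule.add_mem _ (ha g hg) (hb g hg)
      zero_mem' := fun g hg => by
        rw [smul_zero]
        exact Submodule.zero_mem _
      smul_mem' := fun u a ha g hg => by
        rw [← mul_smul]
        exact ha _ (perp_mul_right hg u) }

variable {C : Submodule (WithConv (A →ₗ[k] k)) A}

theorem mem_filt_succ {n : ℕ} {a : A} : a ∈ filt C (n + 1) ↔
    ∀ g : WithConv (A →ₗ[k] k), (∀ c ∈ C, g.ofConv c = 0) → g • a ∈ filt C n :=
  Iff.rfl

theorem filt_mono : Monotone (filt C) :=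
  monotone_nat_of_le_succ fun n _ ha => mem_filt_succ.2 fun g _ => (filt C n).smul_mem g ha

/-- The wedge of two wedge powers is contained in a wedge power. -/
theorem mem_filt_add {m n : ℕ} {a : A}
    (h : ∀ g : WithConv (A →ₗ[k] k), (∀ c ∈ filt C n, g.ofConv c = 0) → g • a ∈ filt C m) :
    a ∈ filt C (m + n) := by
  induction n generalizing a with
  | zero =>
    rw [← one_smul (WithConv (A →ₗ[k] k)) a]
    refine h 1 fun c hc => ?_
    have : c = 0 := hc
    rw [this, map_zero]
  | succ n ih =>
    refine mem_filt_succ.2 fun g hg => ih fun f hf => ?_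
    rw [← mul_smul]
    refine h _ fun c hc => ?_
    rw [← dual_smul]
    exact hf _ (mem_filt_succ.1 hc g hg)

variable {𝒜 : ZMod 2 → Submodule k A} [DirectSum.Decomposition 𝒜] [IsSuperCoalgebra k 𝒜]

theorem isGraded_filt (hC : IsGraded 𝒜 (C : Set A)) (n : ℕ) :
    IsGraded 𝒜 (filt C n : Set A) := by
  induction n with
  | zero => exact IsGraded.bot
  | succ n ih =>
    refine fun i a ha => mem_filt_succ.2 fun g hg => ?_
    rw [smul_eq_sum_proj (𝒜 := 𝒜)]
    refine Submodule.sum_mem _ fun j _ => ?_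
    have h := proj_smul_of_mem (proj_mem (dualGrading k 𝒜) j g) (i - j) a
    rw [sub_add_cancel] at h
    rw [← h]
    exact ih _ _ (mem_filt_succ.1 ha _ (hC.proj_perp hg j))

theorem filt_one (hA : IsSuperCocommutative k 𝒜) (hC : IsGraded 𝒜 (C : Set A)) :
    filt C 1 = C := by
  ext a
  constructor
  · intro ha
    refine mem_of_forall_dual (V := C.restrictScalars k) fun f hf => ?_
    rw [dual_eq_counit_smul]
    have : f • a = 0 := mem_filt_succ.1 ha f hf
    rw [this, map_zero]
  · exact fun ha => mem_filt_succ.2 fun g hg => perp_smul hA hC hg ha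

theorem wedgePow_eq_filt (hA : IsSuperCocommutative k 𝒜) (hC : IsGraded 𝒜 (C : Set A)) :
    ∀ n, wedgePow k (C.restrictScalars k) n = (filt C n).restrictScalars k
  | 0 => rfl
  | 1 => by rw [filt_one hA hC]; rfl
  | n + 2 => by
    ext a
    change a ∈ wedge k (wedgePow k (C.restrictScalars k) (n + 1)) _ ↔ _
    rw [wedgePow_eq_filt hA hC (n + 1), mem_wedge_iff]
    rfl

/-- The annihilator of a graded submodule contains the components of its elements, so conditions on
it need only be checked on homogeneous functionals, which are normal. -/
theorem IsGraded.smul_mem_of_homogeneous {V W : Submodule (WithConv (A →ₗ[k] k)) A}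
    (hV : IsGraded 𝒜 (V : Set A)) {a : A}
    (h : ∀ j, ∀ g ∈ dualGrading k 𝒜 j, (∀ c ∈ V, g.ofConv c = 0) → g • a ∈ W)
    {g : WithConv (A →ₗ[k] k)} (hg : ∀ c ∈ V, g.ofConv c = 0) : g • a ∈ W := by
  rw [smul_eq_sum_proj (𝒜 := 𝒜)]
  exact W.sum_mem fun j _ => h j _ (proj_mem _ j g) (hV.proj_perp hg j)

/-- The annihilator of the second term behaves like the square of the annihilator of `C`: it lowers
the filtration by two. In the induction, a homogeneous `g` is moved past `h` by `g * h = h' * g`,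
where `h'` still annihilates the second term. -/
theorem smul_mem_filt (hA : IsSuperCocommutative k 𝒜) (hC : IsGraded 𝒜 (C : Set A)) {n : ℕ}
    {a : A} (ha : a ∈ filt C (n + 2)) {h : WithConv (A →ₗ[k] k)}
    (hh : ∀ c ∈ filt C 2, h.ofConv c = 0) : h • a ∈ filt C n := by
  induction n generalizing a h with
  | zero =>
    rw [perp_smul hA (isGraded_filt hC 2) hh ha]
    exact Submodule.zero_mem _
  | succ n ih =>
    refine mem_filt_succ.2 fun g hg => hC.smul_mem_of_homogeneous (fun j g hgj hg => ?_) hg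
    obtain ⟨h', e, hh'⟩ := exists_mul_eq_mul_left hA hgj h
    rw [← mul_smul, e, mul_smul]
    exact ih (mem_filt_succ.1 ha g hg) (hh' _ (isGraded_filt hC 2) hh)

/-! ### Generators of the annihilator of the coradical -/

/-- A subspace of the dual is finitely generated modulo the annihilator of a finite-dimensional
subspace. -/
theorem exists_finset_span_mod_perp (V : Submodule k A) [FiniteDimensional k V]
    (J : Submodule k (WithConv (A →ₗ[k] k))) :
    ∃ s : Finset (WithConv (A →ₗ[k] k)), (s : Set (WithConv (A →ₗ[k] k))) ⊆ J ∧
      ∀ f ∈ J, ∃ w ∈ Submodule.span k (s : Set (WithConv (A →ₗ[k] k))),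
        ∀ c ∈ V, (f - w).ofConv c = 0 := by
  classical
  obtain ⟨t, ht⟩ := IsNoetherian.noetherian (J.map (dualRestrict V))
  have hsub : (t : Set _) ⊆ dualRestrict V '' J := by
    rw [← Submodule.map_coe, ← ht]
    exact Submodule.subset_span
  obtain ⟨s, hsJ, hst⟩ := Finset.subset_set_image_iff.1 hsub
  refine ⟨s, hsJ, fun f hf => ?_⟩
  have h1 : dualRestrict V f ∈
      Submodule.map (dualRestrict V) (Submodule.span k (s : Set (WithConv (A →ₗ[k] k)))) := by
    rw [Submodule.map_span, ← Finset.coe_image, hst, ht]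
    exact Submodule.mem_map_of_mem hf
  obtain ⟨w, hw, hwf⟩ := h1
  refine ⟨w, hw, fun c hc => ?_⟩
  have := LinearMap.congr_fun hwf ⟨c, hc⟩
  change w.ofConv c = f.ofConv c at this
  simp [this]

/-- `G` generates the annihilator of `C` modulo the annihilator of `C ⊓ C`. -/
def Generates (C : Submodule (WithConv (A →ₗ[k] k)) A) (G : Finset (WithConv (A →ₗ[k] k))) :
    Prop :=
  ∀ f : WithConv (A →ₗ[k] k), (∀ c ∈ C, f.ofConv c = 0) →
    ∃ w ∈ Submodule.span k (G : Set (WithConv (A →ₗ[k] k))),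
      ∀ c ∈ filt C 2, (f - w).ofConv c = 0

theorem exists_homogeneous_generators (hC : IsGraded 𝒜 (C : Set A))
    (hfin : FiniteDimensional k ((filt C 2).restrictScalars k)) :
    ∃ G : Finset (WithConv (A →ₗ[k] k)),
      (∀ g ∈ G, (∀ c ∈ C, g.ofConv c = 0) ∧ ∃ j, g ∈ dualGrading k 𝒜 j) ∧
      Generates C G := by
  classical
  let J : Submodule k (WithConv (A →ₗ[k] k)) :=
    { carrier := {f | ∀ c ∈ C, f.ofConv c = 0}
      add_mem' := fun {f g} hf hg c hc => by simp [hf c hc, hg c hc]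
      zero_mem' := fun c _ => by simp
      smul_mem' := fun r f hf c hc => by simp [hf c hc] }
  obtain ⟨s, hsJ, hs⟩ := exists_finset_span_mod_perp ((filt C 2).restrictScalars k) J
  refine ⟨(s ×ˢ Finset.univ).image fun p => proj k (dualGrading k 𝒜) p.2 p.1, ?_, ?_⟩
  · intro g hg
    obtain ⟨p, hp, rfl⟩ := Finset.mem_image.1 hg
    exact ⟨hC.proj_perp (hsJ (Finset.mem_product.1 hp).1) p.2, p.2, proj_mem _ _ _⟩
  · intro f hf
    obtain ⟨w, hw, hwf⟩ := hs f hf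
    suffices hle : (s : Set (WithConv (A →ₗ[k] k))) ⊆ Submodule.span k
        (((s ×ˢ Finset.univ).image fun p => proj k (dualGrading k 𝒜) p.2 p.1 :
          Finset (WithConv (A →ₗ[k] k))) : Set (WithConv (A →ₗ[k] k))) from
      ⟨w, Submodule.span_le.2 hle hw, hwf⟩
    intro g hg
    rw [SetLike.mem_coe]
    rw [← sum_proj (k := k) (dualGrading k 𝒜) g]
    refine Submodule.sum_mem _ fun j _ => Submodule.subset_span ?_
    exact Finset.mem_coe.2 (Finset.mem_image.2 ⟨(g, j), Finset.mem_product.2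
      ⟨hg, Finset.mem_univ _⟩, rfl⟩)

/-- Write `f` in the annihilator of `C` as `w + (f - w)` with `w` in the span of `G`. The first
summand sends `a` into `filt C n` by assumption, the second because it lowers the filtration by two.
-/
theorem Generates.mem_filt_succ (hA : IsSuperCocommutative k 𝒜) (hC : IsGraded 𝒜 (C : Set A))
    {G : Finset (WithConv (A →ₗ[k] k))} (hG : Generates C G) {n : ℕ} {a : A}
    (ha : a ∈ filt C (n + 2)) (h : ∀ g ∈ G, g • a ∈ filt C n) : a ∈ filt C (n + 1) := by
  refine SuperCoalg.mem_filt_succ.2 fun f hf => ?_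
  obtain ⟨w, hw, hfw⟩ := hG f hf
  have h1 : w • a ∈ filt C n := by
    clear hfw
    induction hw using Submodule.span_induction with
    | mem g hg => exact h g hg
    | zero =>
      convert Submodule.zero_mem (filt C n)
      exact zero_smul (WithConv (A →ₗ[k] k)) a
    | add x y _ _ hx hy => rw [add_smul]; exact Submodule.add_mem _ hx hy
    | smul r x _ hx =>
      rw [smul_assoc]
      exact ((filt C n).restrictScalars k).smul_mem r hx
  have h2 := Submodule.add_mem _ (smul_mem_filt hA hC ha hfw) h1
  rwa [← add_smul, sub_add_cancel] at h2

/-- Dual form of Nakayama's lemma: starting from any term that contains `a`, the preceding lemma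
lowers the index one step at a time until it reaches `n + 1`. -/
theorem Generates.mem_filt_of_mem (hA : IsSuperCocommutative k 𝒜) (hC : IsGraded 𝒜 (C : Set A))
    {G : Finset (WithConv (A →ₗ[k] k))} (hG : Generates C G) {m n : ℕ} {a : A}
    (ha : a ∈ filt C m) (h : ∀ g ∈ G, g • a ∈ filt C n) : a ∈ filt C (n + 1) := by
  induction m with
  | zero => exact filt_mono (Nat.zero_le _) ha
  | succ m ih =>
    by_cases hmn : m ≤ n
    · exact filt_mono (Nat.succ_le_succ hmn) ha
    · obtain ⟨m, rfl⟩ : ∃ p, m = p + 1 := ⟨m - 1, by omega⟩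
      exact ih (hG.mem_filt_succ hA hC ha fun g hg => filt_mono (by omega) (h g hg))

/-- If the second term of the filtration is finite-dimensional, so are all. -/
theorem finiteDimensional_filt (hA : IsSuperCocommutative k 𝒜) (hC : IsGraded 𝒜 (C : Set A))
    (hfin : FiniteDimensional k ((filt C 2).restrictScalars k)) (n : ℕ) :
    FiniteDimensional k ((filt C n).restrictScalars k) := by
  obtain ⟨G, hG, hgen⟩ := exists_homogeneous_generators hC hfin
  have key : ∀ n, FiniteDimensional k ((filt C (n + 1)).restrictScalars k) := by
    intro n
    induction n with
    | zero =>
      exact Submodule.finiteDimensional_of_le (S₂ := (filt C 2).restrictScalars k)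
        (filt_mono (by omega : 0 + 1 ≤ 2))
    | succ n ih =>
      let V := (filt C (n + 2)).restrictScalars k
      -- The joint action of the generators takes values in a finite power of the previous term, and
      -- an element killed by all of them lies in the previous term itself.
      let φ : V →ₗ[k] (G → A) := LinearMap.pi fun g => dualAct g.1 ∘ₗ V.subtype
      let W : Submodule k (G → A) := Submodule.pi Set.univ fun _ =>
        (filt C (n + 1)).restrictScalars k
      have hW : FiniteDimensional k W := by
        let e : W →ₗ[k] (G → (filt C (n + 1)).restrictScalars k) :=
          LinearMap.pi fun g => (LinearMap.proj g ∘ₗ W.subtype).codRestrict _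
            fun w => w.2 g (Set.mem_univ g)
        refine FiniteDimensional.of_injective e fun x y hxy => ?_
        ext g
        exact congrArg Subtype.val (congrFun hxy g)
      have hφW : LinearMap.range φ ≤ W := by
        rintro _ ⟨v, rfl⟩ g -
        exact mem_filt_succ.1 v.2 g.1 (hG g.1 g.2).1
      have h1 : FiniteDimensional k (LinearMap.range φ) := Submodule.finiteDimensional_of_le hφW
      have h2 : FiniteDimensional k (LinearMap.ker φ) := by
        let e : LinearMap.ker φ →ₗ[k] (filt C (n + 1)).restrictScalars k :=
          (V.subtype ∘ₗ (LinearMap.ker φ).subtype).codRestrict _ fun v =>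
            hgen.mem_filt_succ hA hC v.1.2 fun g hg => by
              have h0 : g • (v.1 : A) = 0 := congrFun v.2 ⟨g, hg⟩
              change g • (v.1 : A) ∈ _
              rw [h0]
              exact Submodule.zero_mem _
        refine FiniteDimensional.of_injective e fun x y hxy => ?_
        have h := congrArg Subtype.val hxy
        exact Subtype.ext (Subtype.ext h)
      have h3 := Module.Finite.equiv φ.quotKerEquivRange.symm
      exact Module.Finite.of_submodule_quotient (LinearMap.ker φ)
  cases n with
  | zero =>
    exact Submodule.finiteDimensional_of_le (S₂ := (filt C 2).restrictScalars k)
      (filt_mono (by omega : 0 ≤ 2))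
  | succ n => exact key n

end Filtration

/-! ### The coradical: exhaustion of the coalgebra and evenness -/

section Coradical

variable {k : Type*} [Field k] {A : Type*} [AddCommGroup A] [Module k A] [Coalgebra k A]
  (𝒜 : ZMod 2 → Submodule k A) [DirectSum.Decomposition 𝒜]

/-- The coradical as a submodule over the dual algebra. -/
def coradMod : Submodule (WithConv (A →ₗ[k] k)) A :=
  sSup {V | IsSimpleSubSuperCoalgebra k 𝒜 (V.restrictScalars k)}

variable [IsSuperCoalgebra k 𝒜]

theorem restrictScalars_coradMod : (coradMod 𝒜).restrictScalars k = corad k 𝒜 := by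
  apply le_antisymm
  · intro a ha
    have ha' : a ∈ coradMod 𝒜 := ha
    rw [coradMod, sSup_eq_iSup'] at ha'
    refine Submodule.iSup_induction _ (motive := fun x => x ∈ corad k 𝒜) ha' ?_
      (Submodule.zero_mem _) (fun _ _ => Submodule.add_mem _)
    exact fun V x hx => (le_sSup V.2 : _ ≤ corad k 𝒜) hx
  · refine sSup_le fun B hB => ?_
    obtain ⟨V, rfl, hV⟩ := hB.1.exists_submodule
    have : V ≤ coradMod 𝒜 := le_sSup hB
    exact this

theorem isGraded_coradMod : IsGraded 𝒜 (coradMod 𝒜 : Set A) :=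
  IsGraded.sSup fun _ hV => isGraded_iff_isHomogeneous.2 hV.1.1

/-- The indices differ by one because `filt` starts with `0`; thus `A_1` is `filt (coradMod 𝒜) 2`.
-/
theorem coradFiltration_eq (hA : IsSuperCocommutative k 𝒜) (n : ℕ) :
    coradFiltration k 𝒜 n = (filt (coradMod 𝒜) (n + 1)).restrictScalars k := by
  rw [coradFiltration, ← restrictScalars_coradMod, wedgePow_eq_filt hA (isGraded_coradMod 𝒜)]

variable {𝒜}

theorem exists_minimal {P : Submodule (WithConv (A →ₗ[k] k)) A}
    (hP : FiniteDimensional k (P.restrictScalars k))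
    (Q : Submodule (WithConv (A →ₗ[k] k)) A → Prop) (hQ : Q P) :
    ∃ M ≤ P, Q M ∧ ∀ M' < M, ¬ Q M' := by
  induction hn : Module.finrank k (P.restrictScalars k) using Nat.strong_induction_on
    generalizing P with
  | _ n ih =>
    by_cases h : ∃ M' < P, Q M'
    · obtain ⟨M', hM', hQ'⟩ := h
      have hlt : M'.restrictScalars k < P.restrictScalars k := hM'
      obtain ⟨M, hM, hQM⟩ := ih _ (hn ▸ Submodule.finrank_lt_finrank_of_lt hlt)
        (Submodule.finiteDimensional_of_le hlt.le) hQ' rfl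
      exact ⟨M, hM.trans hM'.le, hQM⟩
    · exact ⟨P, le_rfl, hQ, fun M' hM' hQ' => h ⟨M', hM', hQ'⟩⟩

theorem exists_simple_le (hA : IsSuperCocommutative k 𝒜)
    {P : Submodule (WithConv (A →ₗ[k] k)) A}
    (hP : FiniteDimensional k (P.restrictScalars k)) (hgr : IsGraded 𝒜 (P : Set A))
    (h0 : P ≠ ⊥) : ∃ E ≤ P, IsSimpleSubSuperCoalgebra k 𝒜 (E.restrictScalars k) := by
  obtain ⟨E, hEP, ⟨hE, hE0⟩, hmin⟩ := exists_minimal hP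
    (fun V => IsGraded 𝒜 (V : Set A) ∧ V ≠ ⊥) ⟨hgr, h0⟩
  refine ⟨E, hEP, (isSubSuperCoalgebra_iff hA).2 hE, fun h => hE0 ?_, fun B hB hBE => ?_⟩
  · exact (Submodule.restrictScalars_eq_bot_iff _ _ _).1 h
  · obtain ⟨V, rfl, hV⟩ := hB.exists_submodule
    have hle : V ≤ E := hBE
    rcases hle.eq_or_lt with rfl | hlt
    · exact Or.inr rfl
    · left
      by_contra hV0
      exact hmin V hlt ⟨hV, fun h => hV0 (by rw [h]; rfl)⟩

theorem perp_coradMod_smul (hA : IsSuperCocommutative k 𝒜) {f : WithConv (A →ₗ[k] k)}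
    (hf : ∀ c ∈ coradMod 𝒜, f.ofConv c = 0) {E : Submodule (WithConv (A →ₗ[k] k)) A}
    (hE : IsSimpleSubSuperCoalgebra k 𝒜 (E.restrictScalars k)) {e : A} (he : e ∈ E) :
    f • e = 0 :=
  perp_smul hA (isGraded_coradMod 𝒜) hf ((le_sSup hE : E ≤ coradMod 𝒜) he)

/-- A homogeneous element of the annihilator of the coradical is nilpotent on
finite-dimensional sub-super-coalgebras. -/
theorem exists_pow_smul_eq_zero (hA : IsSuperCocommutative k 𝒜) {j : ZMod 2}
    {f : WithConv (A →ₗ[k] k)} (hfj : f ∈ dualGrading k 𝒜 j)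
    (hf : ∀ c ∈ coradMod 𝒜, f.ofConv c = 0) {D : Submodule (WithConv (A →ₗ[k] k)) A}
    (hD : FiniteDimensional k (D.restrictScalars k)) (hgr : IsGraded 𝒜 (D : Set A)) :
    ∃ n : ℕ, ∀ d ∈ D, f ^ n • d = 0 := by
  induction hn : Module.finrank k (D.restrictScalars k) using Nat.strong_induction_on
    generalizing D with
  | _ n ih =>
    obtain ⟨W, hW, hWD, hWgr⟩ := exists_smul_submodule hA hfj D
    rcases hWD.eq_or_lt with rfl | hlt
    · by_cases h0 : W = ⊥
      · refine ⟨0, fun d hd => ?_⟩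
        rw [h0] at hd
        have : d = 0 := hd
        rw [this, smul_zero]
      -- Here `f` maps `W` onto itself, so it is injective by finite dimension; yet it kills the
      -- simple `E` inside `W`.
      · obtain ⟨E, hEW, hE⟩ := exists_simple_le hA hD hgr h0
        exfalso
        let φ : W.restrictScalars k →ₗ[k] W.restrictScalars k :=
          (dualAct f).restrict fun x hx => W.smul_mem f hx
        have hsurj : Function.Surjective φ := by
          intro x
          obtain ⟨v, hv, hvx⟩ := (hW x).1 x.2
          exact ⟨⟨v, hv⟩, Subtype.ext hvx⟩
        have hinj := LinearMap.injective_iff_surjective.2 hsurj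
        refine hE.2.1 ((Submodule.eq_bot_iff _).2 fun e he => ?_)
        have : (⟨e, hEW he⟩ : W.restrictScalars k) = 0 := by
          apply hinj
          rw [map_zero]
          exact Subtype.ext (perp_coradMod_smul hA hf hE he)
        exact congrArg Subtype.val this
    · have hlt' : W.restrictScalars k < D.restrictScalars k := hlt
      obtain ⟨m, hm⟩ := ih _ (hn ▸ Submodule.finrank_lt_finrank_of_lt hlt')
        (Submodule.finiteDimensional_of_le hlt'.le) (hWgr hgr) rfl
      refine ⟨m + 1, fun d hd => ?_⟩
      rw [pow_succ, mul_smul]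
      exact hm _ ((hW _).2 ⟨d, hd, rfl⟩)

/-- `D` is built up by minimal graded extensions `N < M`. If `f` is homogeneous and annihilates the
coradical, nilpotence of `f` excludes `N + f • M = M`, so `f • M ≤ N` by minimality; each extension
therefore costs one step of the filtration. -/
theorem exists_le_filt (hA : IsSuperCocommutative k 𝒜)
    {D : Submodule (WithConv (A →ₗ[k] k)) A}
    (hD : FiniteDimensional k (D.restrictScalars k)) (hgr : IsGraded 𝒜 (D : Set A)) :
    ∃ n, D ≤ filt (coradMod 𝒜) n := by
  -- `d` bounds the codimension in `D` of a graded submodule `N` already known to lie in the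
  -- filtration.
  suffices H : ∀ d : ℕ, ∀ N ≤ D, IsGraded 𝒜 (N : Set A) → (∃ n, N ≤ filt (coradMod 𝒜) n) →
      Module.finrank k (D.restrictScalars k) ≤ Module.finrank k (N.restrictScalars k) + d →
      ∃ n, D ≤ filt (coradMod 𝒜) n from
    H _ ⊥ bot_le IsGraded.bot ⟨0, le_rfl⟩ (Nat.le_add_left _ _)
  intro d
  induction d with
  | zero =>
    rintro N hND - ⟨n, hn⟩ hrk
    have : N.restrictScalars k = D.restrictScalars k :=
      Submodule.eq_of_le_of_finrank_le hND hrk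
    have h2 : N = D := Submodule.restrictScalars_injective k _ _ this
    exact ⟨n, h2 ▸ hn⟩
  | succ d ih =>
    rintro N hND hNgr ⟨n, hn⟩ hrk
    by_cases hDN : D ≤ N
    · exact ⟨n, hDN.trans hn⟩
    obtain ⟨M, hMD, ⟨hMgr, hNM, hMN⟩, hmin⟩ := exists_minimal hD
      (fun V => IsGraded 𝒜 (V : Set A) ∧ N ≤ V ∧ ¬ V ≤ N) ⟨hgr, hND, hDN⟩
    have hMf : M ≤ filt (coradMod 𝒜) (n + 1) := by
      refine fun m hm => mem_filt_succ.2 fun f hf => hn ?_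
      refine (isGraded_coradMod 𝒜).smul_mem_of_homogeneous (fun j f hfj hf => ?_) hf
      obtain ⟨W, hW, hWM, hWgr⟩ := exists_smul_submodule hA hfj M
      have hle : N ⊔ W ≤ M := sup_le hNM hWM
      rcases hle.eq_or_lt with heq | hlt
      · exfalso
        obtain ⟨p, hp⟩ := exists_pow_smul_eq_zero hA hfj hf hD hgr
        -- Iterating `M = N + f • M` gives `M = N + f ^ q • M`, which is `N` once `f ^ q` vanishes
        -- on `D`.
        have key : ∀ q : ℕ, ∀ x ∈ M, ∃ y ∈ N, ∃ z ∈ M, x = y + f ^ q • z := by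
          intro q
          induction q with
          | zero => exact fun x hx => ⟨0, N.zero_mem, x, hx, by simp⟩
          | succ q ihq =>
            intro x hx
            obtain ⟨y, hy, z, hz, rfl⟩ := ihq x hx
            obtain ⟨y', hy', w, hw, rfl⟩ := Submodule.mem_sup.1 (heq.symm ▸ hz : z ∈ N ⊔ W)
            obtain ⟨v, hv, rfl⟩ := (hW w).1 hw
            refine ⟨y + f ^ q • y', N.add_mem hy (N.smul_mem _ hy'), v, hv, ?_⟩
            rw [smul_add, pow_succ, mul_smul, add_assoc]
        refine hMN fun x hx => ?_
        obtain ⟨y, hy, z, hz, rfl⟩ := key p x hx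
        rw [hp z (hMD hz), add_zero]
        exact hy
      · have := hmin _ hlt
        by_contra hfm
        refine this ⟨hNgr.sup (hWgr hMgr), le_sup_left, fun h => hfm (h ?_)⟩
        exact (le_sup_right : W ≤ N ⊔ W) ((hW _).2 ⟨m, hm, rfl⟩)
    refine ih M hMD hMgr ⟨n + 1, hMf⟩ ?_
    have hlt : N.restrictScalars k < M.restrictScalars k := lt_of_le_not_ge hNM hMN
    have : FiniteDimensional k (M.restrictScalars k) :=
      Submodule.finiteDimensional_of_le (S₂ := D.restrictScalars k) hMD
    have := Submodule.finrank_lt_finrank_of_lt hlt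
    omega

theorem exists_mem_filt (hA : IsSuperCocommutative k 𝒜) (a : A) :
    ∃ n, a ∈ filt (coradMod 𝒜) n := by
  obtain ⟨n, hn⟩ := exists_le_filt hA (finiteDimensional_gradedSpan (𝒜 := 𝒜) a)
    (isGraded_gradedSpan a)
  exact ⟨n, hn (mem_gradedSpan a)⟩

/-- Odd elements of the dual act trivially on the coradical. -/
theorem odd_smul_coradMod (hk : ringChar k ≠ 2) (hA : IsSuperCocommutative k 𝒜)
    {f : WithConv (A →ₗ[k] k)} (hf : f ∈ dualGrading k 𝒜 1) {a : A} (ha : a ∈ coradMod 𝒜) :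
    f • a = 0 := by
  rw [coradMod, sSup_eq_iSup'] at ha
  refine Submodule.iSup_induction _ (motive := fun x => f • x = 0) ha ?_ (smul_zero f) ?_
  · rintro ⟨E, hE⟩ e he
    -- By simplicity `f • E` is `0` or `E`. In the second case `e = f • v`, so `f • e = (f * f) • v
    -- = 0`.
    obtain ⟨W, hW, hWE, hWgr⟩ := exists_smul_submodule hA hf E
    have hgr := hWgr (isGraded_iff_isHomogeneous.2 hE.1.1)
    rcases hE.2.2 (W.restrictScalars k) ((isSubSuperCoalgebra_iff hA).2 hgr) hWE with h | h
    · have : f • e ∈ W.restrictScalars k := (hW _).2 ⟨e, he, rfl⟩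
      rw [h] at this
      exact this
    · have he' : e ∈ W.restrictScalars k := by
        rw [h]
        exact he
      obtain ⟨v, -, rfl⟩ := (hW _).1 he'
      rw [← mul_smul, mul_self_of_odd hk hA hf]
      exact zero_smul (WithConv (A →ₗ[k] k)) v
  · intro x y hx hy
    rw [smul_add, hx, hy, add_zero]

/-- The coradical is purely even. -/
theorem coradMod_le_even (hk : ringChar k ≠ 2) (hA : IsSuperCocommutative k 𝒜) {a : A}
    (ha : a ∈ coradMod 𝒜) : a ∈ 𝒜 0 := by
  refine mem_grading_of_forall_dual 𝒜 fun m hm g hg => ?_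
  have hm1 : ∀ m : ZMod 2, m ≠ 0 → m = 1 := by decide
  obtain rfl := hm1 m hm
  rw [dual_eq_counit_smul, odd_smul_coradMod hk hA hg ha, map_zero]

end Coradical

/-! ### Biduals and finite codimension -/

section LinearAlgebra

universe u v

/-- An infinite-dimensional space has strictly smaller dimension than its dual. Applied twice, this
makes the bidual too large to be isomorphic to `V`; the rest is universe bookkeeping for cardinals.
-/
theorem finite_of_dual_eval_surjective (k : Type u) [Field k] (V : Type v) [AddCommGroup V]
    [Module k V] (h : Function.Surjective (Module.Dual.eval k V)) : FiniteDimensional k V := by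
  by_contra hV
  have h0 : Cardinal.aleph0 ≤ Module.rank k V := by
    by_contra hlt
    exact hV (Module.rank_lt_aleph0_iff.1 (not_le.1 hlt))
  have h1 := lift_rank_lt_rank_dual (K := k) h0
  have h1' : Cardinal.aleph0 ≤ Module.rank k (Module.Dual k V) :=
    le_trans (by simpa using h0) h1.le
  have h2 := lift_rank_lt_rank_dual (K := k) h1'
  have e := LinearEquiv.ofBijective (Module.Dual.eval k V)
    ⟨Module.eval_apply_injective k (V := V), h⟩
  have h3 := e.lift_rank_eq
  have h3' : Cardinal.lift.{u, v} (Module.rank k V) =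
      Module.rank k (Module.Dual k (Module.Dual k V)) := by
    rwa [Cardinal.lift_id'.{v, max u v}, Cardinal.lift_umax.{v, u}] at h3
  have h2' : Module.rank k (Module.Dual k V) < Module.rank k (Module.Dual k (Module.Dual k V)) := by
    rwa [Cardinal.lift_id'.{u, max u v}] at h2
  rw [← h3'] at h2'
  exact lt_asymm h1 h2'

variable {k : Type*} [Field k] {R : Type*} [Ring R] [Algebra k R]

theorem finiteDimensional_quotient_of_ker_le {I : Ideal R} {W : Type*} [AddCommGroup W]
    [Module k W] [FiniteDimensional k W] (φ : R →ₗ[k] W) (h : ∀ x, φ x = 0 → x ∈ I) :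
    FiniteDimensional k (R ⧸ I) := by
  have h1 : FiniteDimensional k (R ⧸ LinearMap.ker φ) :=
    Module.Finite.equiv φ.quotKerEquivRange.symm
  have hle : LinearMap.ker φ ≤ LinearMap.ker (I.mkQ.restrictScalars k) := fun x hx =>
    (Submodule.Quotient.mk_eq_zero I).2 (h x hx)
  refine Module.Finite.of_surjective ((LinearMap.ker φ).liftQ (I.mkQ.restrictScalars k) hle) ?_
  intro y
  obtain ⟨x, rfl⟩ := I.mkQ_surjective y
  exact ⟨(LinearMap.ker φ).mkQ x, rfl⟩

end LinearAlgebra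

/-! ### Reflexivity and the finite dual -/

section Reflexive

variable {k : Type*} [Field k] {A : Type*} [AddCommGroup A] [Module k A] [Coalgebra k A]
  {𝒜 : ZMod 2 → Submodule k A} [DirectSum.Decomposition 𝒜] [IsSuperCoalgebra k 𝒜]

/-- A homogeneous left ideal of the dual is a superideal. -/
theorem isSuperideal_of_isHomogeneous (hA : IsSuperCocommutative k 𝒜)
    {I : Ideal (WithConv (A →ₗ[k] k))} (hI : I.IsHomogeneous (dualGrading k 𝒜)) :
    IsSuperideal (dualGrading k 𝒜) I := by
  refine ⟨⟨fun {f} u hf => ?_⟩, hI⟩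
  rw [← sum_proj (k := k) (dualGrading k 𝒜) f, Finset.sum_mul]
  refine Ideal.sum_mem _ fun i _ => ?_
  obtain ⟨u', hu', -⟩ := exists_mul_eq_mul_left hA (proj_mem (dualGrading k 𝒜) i f) u
  rw [hu']
  exact I.mul_mem_left _ (hI i hf)

/-- The annihilator of a graded submodule as an ideal of the dual. -/
def perpIdeal (hA : IsSuperCocommutative k 𝒜) (V : Submodule (WithConv (A →ₗ[k] k)) A)
    (hV : IsGraded 𝒜 (V : Set A)) : Ideal (WithConv (A →ₗ[k] k)) where
  carrier := {f | ∀ a ∈ V, f.ofConv a = 0}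
  add_mem' := fun {f g} hf hg c hc => by simp [hf c hc, hg c hc]
  zero_mem' := fun c _ => by simp
  smul_mem' := fun u _ hf => perp_mul_left hA hV hf u

theorem isSuperideal_perpIdeal (hA : IsSuperCocommutative k 𝒜)
    (V : Submodule (WithConv (A →ₗ[k] k)) A) (hV : IsGraded 𝒜 (V : Set A)) :
    IsSuperideal (dualGrading k 𝒜) (perpIdeal hA V hV) :=
  isSuperideal_of_isHomogeneous hA fun i _ hf => hV.proj_perp hf i

theorem finiteDimensional_quotient_perpIdeal (hA : IsSuperCocommutative k 𝒜)
    (V : Submodule (WithConv (A →ₗ[k] k)) A) (hV : IsGraded 𝒜 (V : Set A))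
    (hfin : FiniteDimensional k (V.restrictScalars k)) :
    FiniteDimensional k (WithConv (A →ₗ[k] k) ⧸ perpIdeal hA V hV) :=
  finiteDimensional_quotient_of_ker_le (dualRestrict (V.restrictScalars k)) fun _ hx =>
    dualRestrict_eq_zero_iff.1 hx

/-- A functional vanishing on the elements that finitely many elements of the dual map to a
subspace is a combination of these. -/
theorem exists_eq_sum_mul (V : Submodule k A) (G : Finset (WithConv (A →ₗ[k] k)))
    (h : WithConv (A →ₗ[k] k))
    (hh : ∀ a : A, (∀ g ∈ G, g • a ∈ V) → h.ofConv a = 0) :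
    ∃ c : WithConv (A →ₗ[k] k) → WithConv (A →ₗ[k] k),
      (∀ g ∈ G, ∀ a ∈ V, (c g).ofConv a = 0) ∧ h = ∑ g ∈ G, c g * g := by
  classical
  -- The hypothesis says that `h` kills the kernel of this map, so `h` factors through it; the
  -- components of the factor are the coefficients `c g`.
  let φ : A →ₗ[k] (G → A ⧸ V) := LinearMap.pi fun g => V.mkQ ∘ₗ dualAct g.1
  have hmem : h.ofConv ∈ LinearMap.range φ.dualMap := by
    rw [LinearMap.range_dualMap_eq_dualAnnihilator_ker, Submodule.mem_dualAnnihilator]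
    intro a ha
    refine hh a fun g hg => ?_
    exact (Submodule.Quotient.mk_eq_zero V).1 (congrFun ha ⟨g, hg⟩)
  obtain ⟨ψ, hψ⟩ := hmem
  let c : WithConv (A →ₗ[k] k) → WithConv (A →ₗ[k] k) := fun g =>
    if hg : g ∈ G then WithConv.toConv (ψ ∘ₗ LinearMap.single k (fun _ => A ⧸ V) ⟨g, hg⟩ ∘ₗ V.mkQ)
    else 0
  refine ⟨c, ?_, ?_⟩
  · intro g hg a ha
    have : V.mkQ a = 0 := (Submodule.Quotient.mk_eq_zero V).2 ha
    simp only [c, dif_pos hg, LinearMap.comp_apply, this, map_zero]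
  · apply WithConv.ext
    ext a
    have h1 : h.ofConv a = ψ (φ a) := (LinearMap.congr_fun hψ a).symm
    rw [h1, WithConv.ofConv_sum, LinearMap.sum_apply, ← Finset.sum_coe_sort G]
    have h2 : φ a = ∑ g : G, LinearMap.single k (fun _ => A ⧸ V) g (φ a g) := by
      ext g
      simp
    conv_lhs => rw [h2, map_sum]
    refine Finset.sum_congr rfl fun g _ => ?_
    rw [← dual_smul]
    simp only [c, dif_pos g.2]
    rfl

/-- The annihilator of the coradical is contained in the Jacobson radical. -/
theorem exists_mul_one_add_eq_one (hA : IsSuperCocommutative k 𝒜) {f : WithConv (A →ₗ[k] k)}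
    (hf : ∀ c ∈ coradMod 𝒜, f.ofConv c = 0) : ∃ z : WithConv (A →ₗ[k] k), z * (1 + f) = 1 := by
  -- If `a = -(f • a)`, then `a` moves down the filtration one term at a time until it reaches `0`.
  have hinj : ∀ a : A, (1 + f) • a = 0 → a = 0 := by
    intro a ha
    rw [add_smul, one_smul] at ha
    obtain ⟨n, hn⟩ := exists_mem_filt hA a
    induction n with
    | zero => exact hn
    | succ n ih =>
      refine ih ?_
      rw [eq_neg_of_add_eq_zero_left ha]
      exact Submodule.neg_mem _ (mem_filt_succ.1 hn f hf)
  obtain ⟨p, hp⟩ := LinearMap.exists_leftInverse_of_injective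
    (dualAct (1 + f) : A →ₗ[k] A) (LinearMap.ker_eq_bot'.2 hinj)
  -- With `p` a linear left inverse of the action of `1 + f`, the functional `z = ε ∘ p` satisfies
  -- `z((1 + f) • a) = ε(a)`.
  refine ⟨WithConv.toConv ((1 : WithConv (A →ₗ[k] k)).ofConv ∘ₗ p), ?_⟩
  apply WithConv.ext
  ext a
  rw [← dual_smul]
  exact congrArg _ (LinearMap.congr_fun hp a)

/-- Superideals of finite codimension contain the annihilator of a term of the coradical
filtration. -/
theorem exists_perp_filt_le (hA : IsSuperCocommutative k 𝒜)
    (hfin : FiniteDimensional k ((filt (coradMod 𝒜) 2).restrictScalars k))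
    {I : Ideal (WithConv (A →ₗ[k] k))} [I.IsTwoSided]
    (hI : FiniteDimensional k (WithConv (A →ₗ[k] k) ⧸ I)) :
    ∃ n, ∀ f : WithConv (A →ₗ[k] k), (∀ c ∈ filt (coradMod 𝒜) n, f.ofConv c = 0) → f ∈ I := by
  obtain ⟨G, hG, hgen⟩ := exists_homogeneous_generators (isGraded_coradMod 𝒜) hfin
  have hart : IsArtinianRing (WithConv (A →ₗ[k] k) ⧸ I) := isArtinian_of_tower k inferInstance
  obtain ⟨n, hn⟩ := IsSemiprimaryRing.isNilpotent (R := WithConv (A →ₗ[k] k) ⧸ I)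
  refine ⟨n, fun f hf => ?_⟩
  -- Elements annihilating the `m`-th term are sent to the `m`-th power of the Jacobson radical of
  -- the Artinian quotient, and this radical is nilpotent of exponent `n`. In the induction `f = ∑ c
  -- g * g`, with `c g` annihilating the `m`-th term and `g` going to the radical.
  suffices H : ∀ m, ∀ f : WithConv (A →ₗ[k] k), (∀ c ∈ filt (coradMod 𝒜) m, f.ofConv c = 0) →
      Ideal.Quotient.mk I f ∈ Ring.jacobson (WithConv (A →ₗ[k] k) ⧸ I) ^ m by
    exact Ideal.Quotient.eq_zero_iff_mem.1 (hn.le (H n f hf))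
  intro m
  induction m with
  | zero =>
    intro f _
    rw [Submodule.pow_zero, Ideal.one_eq_top]
    trivial
  | succ m ih =>
    intro f hf
    obtain ⟨c, hc, rfl⟩ := exists_eq_sum_mul ((filt (coradMod 𝒜) m).restrictScalars k) G f
      fun a ha => by
        obtain ⟨p, hp⟩ := exists_mem_filt hA a
        exact hf a (hgen.mem_filt_of_mem hA (isGraded_coradMod 𝒜) hp ha)
    rw [map_sum]
    refine Submodule.sum_mem _ fun g hg => ?_
    rw [map_mul, Submodule.pow_succ]
    refine Ideal.mul_mem_mul (ih _ (hc g hg)) ?_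
    rw [← Ideal.jacobson_bot, Ideal.mem_jacobson_iff]
    intro y
    obtain ⟨y, rfl⟩ := Ideal.Quotient.mk_surjective y
    obtain ⟨z, hz⟩ := exists_mul_one_add_eq_one hA (f := y * g)
      (perp_mul_left hA (isGraded_coradMod 𝒜) (hG g hg).1 y)
    refine ⟨Ideal.Quotient.mk I z, ?_⟩
    rw [← map_mul, ← map_mul, ← map_add, ← map_one (Ideal.Quotient.mk I), ← map_sub]
    have : z * y * g + z - 1 = 0 := by
      rw [← hz]
      noncomm_ring
    rw [this, map_zero]
    exact Submodule.zero_mem _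

/-- The evaluation map from a coalgebra to the finite dual of its dual. -/
def evalFiniteDual (hA : IsSuperCocommutative k 𝒜) : A →ₗ[k] finiteDual k (dualGrading k 𝒜) :=
  (LinearMap.flip (WithConv.linearEquiv k (A →ₗ[k] k)).toLinearMap).codRestrict
    (finiteDual k (dualGrading k 𝒜)) fun a =>
      ⟨perpIdeal hA (gradedSpan 𝒜 a) (isGraded_gradedSpan a), isSuperideal_perpIdeal _ _ _,
        finiteDimensional_quotient_perpIdeal _ _ _ (finiteDimensional_gradedSpan a),
        fun _ hf => hf a (mem_gradedSpan a)⟩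

@[simp] theorem evalFiniteDual_apply (hA : IsSuperCocommutative k 𝒜) (a : A)
    (f : WithConv (A →ₗ[k] k)) :
    (evalFiniteDual hA a : Module.Dual k (WithConv (A →ₗ[k] k))) f = f.ofConv a := rfl

theorem pairing_map_evalFiniteDual (hA : IsSuperCocommutative k 𝒜) (t : A ⊗[k] A)
    (f g : WithConv (A →ₗ[k] k)) :
    pairing k (dualGrading k 𝒜) (TensorProduct.map (evalFiniteDual hA) (evalFiniteDual hA) t)
      (f ⊗ₜ g) = LinearMap.mul' k k (TensorProduct.map f.ofConv g.ofConv t) := by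
  induction t with
  | zero => simp
  | add s t hs ht => simp only [map_add, LinearMap.add_apply, hs, ht]
  | tmul a b => simp

/-- For surjectivity, a functional in the finite dual kills the annihilator of some
finite-dimensional term `V`, so it factors through `V*` and is evaluation at a vector of `V`. -/
theorem evalFiniteDual_bijective (hA : IsSuperCocommutative k 𝒜)
    (hfin : FiniteDimensional k ((filt (coradMod 𝒜) 2).restrictScalars k)) :
    Function.Bijective (evalFiniteDual hA) := by
  constructor
  · intro a b h
    refine eq_of_forall_dual (k := k) fun f => ?_
    rw [← evalFiniteDual_apply hA, h, evalFiniteDual_apply]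
  · rintro ⟨φ, I, hI, hIfin, hφ⟩
    have := hI.1
    obtain ⟨n, hn⟩ := exists_perp_filt_le hA hfin hIfin
    have hF := finiteDimensional_filt hA (isGraded_coradMod 𝒜) hfin n
    let V := (filt (coradMod 𝒜) n).restrictScalars k
    have hker : LinearMap.ker (dualRestrict V) ≤ LinearMap.ker φ := fun f hf =>
      hφ f (hn f (dualRestrict_eq_zero_iff.1 hf))
    obtain ⟨ψ, hψ⟩ : ∃ ψ : Module.Dual k V →ₗ[k] k, ψ ∘ₗ dualRestrict V = φ := by
      refine ⟨(LinearMap.ker (dualRestrict V)).liftQ φ hker ∘ₗ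
        ((dualRestrict V).quotKerEquivOfSurjective (dualRestrict_surjective V)).symm, ?_⟩
      ext f
      rw [LinearMap.comp_apply, LinearMap.comp_apply]
      have : ((dualRestrict V).quotKerEquivOfSurjective (dualRestrict_surjective V)).symm
          (dualRestrict V f) = (LinearMap.ker (dualRestrict V)).mkQ f := by
        rw [LinearEquiv.symm_apply_eq]
        rfl
      erw [this]
      rfl
    obtain ⟨a, ha⟩ := (Module.evalEquiv k V).surjective ψ
    refine ⟨a, Subtype.ext (LinearMap.ext fun f => ?_)⟩
    rw [evalFiniteDual_apply]
    change _ = φ f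
    rw [← hψ, ← ha]
    rfl

/-- Super-coalgebras of finite type are reflexive. -/
theorem isReflexive_of_finite (hA : IsSuperCocommutative k 𝒜)
    (hfin : FiniteDimensional k ((filt (coradMod 𝒜) 2).restrictScalars k)) :
    IsReflexive k 𝒜 := by
  let c : A →ₗc[k] finiteDual k (dualGrading k 𝒜) :=
    { evalFiniteDual hA with
      counit_comp := by
        ext a
        change (1 : WithConv (A →ₗ[k] k)).ofConv a = _
        rw [dual_one]
      map_comp_comul := by
        ext a
        apply pairing_injective k (dualGrading k 𝒜)
        apply TensorProduct.ext'
        intro f g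
        change pairing k _ (TensorProduct.map (evalFiniteDual hA) (evalFiniteDual hA) _) _ =
          pairing k _ (finiteDualComul k _ (evalFiniteDual hA a)) _
        rw [pairing_map_evalFiniteDual, pairing_comul, evalFiniteDual_apply,
          LinearMap.convMul_apply] }
  refine ⟨CoalgEquiv.ofBijective (f := c) (evalFiniteDual_bijective hA hfin), ?_, fun _ _ => rfl⟩
  intro i a ha j hj f hf
  exact hf i hj.symm a ha

/-- Every functional on the dual that comes from `C ⊓ C` lies in the finite dual. -/
theorem mem_finiteDual_of_perp (hA : IsSuperCocommutative k 𝒜)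
    {C : Submodule (WithConv (A →ₗ[k] k)) A} (hC : IsGraded 𝒜 (C : Set A))
    (hfin : FiniteDimensional k (C.restrictScalars k))
    (φ : Module.Dual k (WithConv (A →ₗ[k] k)))
    (hφ : ∀ f : WithConv (A →ₗ[k] k), (∀ c ∈ filt C 2, f.ofConv c = 0) → φ f = 0) :
    φ ∈ finiteDual k (dualGrading k 𝒜) := by
  -- Asking `φ` to vanish on all left multiples of all components makes `I` a homogeneous left ideal
  -- inside the kernel of `φ`; homogeneous left ideals are superideals.
  let I : Ideal (WithConv (A →ₗ[k] k)) :=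
    { carrier := {f | (∀ c ∈ C, f.ofConv c = 0) ∧
        ∀ (u : WithConv (A →ₗ[k] k)) (i : ZMod 2), φ (u * proj k (dualGrading k 𝒜) i f) = 0}
      add_mem' := fun {f g} hf hg => ⟨fun c hc => by simp [hf.1 c hc, hg.1 c hc], fun u i => by
        rw [map_add, mul_add, map_add, hf.2, hg.2, add_zero]⟩
      zero_mem' := ⟨fun c _ => by simp, fun u i => by rw [map_zero, mul_zero, map_zero]⟩
      smul_mem' := fun w f hf => ⟨perp_mul_left hA hC hf.1 w, fun u i => by
        have key : proj k (dualGrading k 𝒜) i (w * f) = ∑ j,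
            proj k (dualGrading k 𝒜) j w * proj k (dualGrading k 𝒜) (i - j) f := by
          conv_lhs => rw [← sum_proj (k := k) (dualGrading k 𝒜) w, Finset.sum_mul, map_sum]
          refine Finset.sum_congr rfl fun j _ => ?_
          conv_lhs => rw [← sum_proj (k := k) (dualGrading k 𝒜) f, Finset.mul_sum, map_sum]
          have hm : ∀ m, proj k (dualGrading k 𝒜) j w * proj k (dualGrading k 𝒜) m f ∈
              dualGrading k 𝒜 (j + m) := fun m =>
            SetLike.mul_mem_graded (proj_mem _ j w) (proj_mem _ m f)
          rw [Finset.sum_eq_single (i - j)]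
          · refine proj_of_mem _ ?_
            have := hm (i - j)
            rwa [add_sub_cancel] at this
          · intro m _ hmj
            exact proj_of_mem_ne _ (fun h => hmj (by rw [← h]; ring)) (hm m)
          · simp
        rw [smul_eq_mul, key, Finset.mul_sum, map_sum]
        refine Finset.sum_eq_zero fun j _ => ?_
        rw [← mul_assoc]
        exact hf.2 _ _⟩ }
  have hIhom : I.IsHomogeneous (dualGrading k 𝒜) := by
    intro m f hf
    refine ⟨hC.proj_perp hf.1 m, fun u i => ?_⟩
    change φ (u * proj k (dualGrading k 𝒜) i (proj k (dualGrading k 𝒜) m f)) = 0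
    by_cases h : m = i
    · subst h
      rw [proj_of_mem _ (proj_mem _ m f)]
      exact hf.2 u m
    · rw [proj_of_mem_ne _ h (proj_mem _ m f), mul_zero, map_zero]
  refine ⟨I, isSuperideal_of_isHomogeneous hA hIhom, ?_, ?_⟩
  -- For `f` annihilating `C`, finitely many multipliers `u` suffice: two that differ by an
  -- annihilator of `C` give products differing by an annihilator of `filt C 2`, which `φ` kills.
  -- Membership in `I` is thus finitely many linear conditions beyond vanishing on `C`.
  · obtain ⟨s, -, hs⟩ := exists_finset_span_mod_perp (C.restrictScalars k) ⊤
    let Φ : WithConv (A →ₗ[k] k) →ₗ[k]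
        Module.Dual k (C.restrictScalars k) × (s × ZMod 2 → k) :=
      (dualRestrict (C.restrictScalars k)).prod (LinearMap.pi fun p =>
        φ ∘ₗ LinearMap.mulLeft k p.1.1 ∘ₗ proj k (dualGrading k 𝒜) p.2)
    refine finiteDimensional_quotient_of_ker_le Φ fun f hf => ?_
    have hf1 : ∀ c ∈ C, f.ofConv c = 0 := dualRestrict_eq_zero_iff.1 (congrArg Prod.fst hf)
    have hf2 : ∀ g ∈ s, ∀ i, φ (g * proj k (dualGrading k 𝒜) i f) = 0 := fun g hg i =>
      congrFun (congrArg Prod.snd hf) (⟨g, hg⟩, i)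
    refine ⟨hf1, fun u i => ?_⟩
    obtain ⟨w, hw, huw⟩ := hs u trivial
    have h1 : φ (w * proj k (dualGrading k 𝒜) i f) = 0 := by
      clear huw
      induction hw using Submodule.span_induction with
      | mem g hg => exact hf2 g hg i
      | zero => rw [zero_mul, map_zero]
      | add x y _ _ hx hy => rw [add_mul, map_add, hx, hy, add_zero]
      | smul r x _ hx => rw [smul_mul_assoc, map_smul, hx, smul_zero]
    have h2 : φ ((u - w) * proj k (dualGrading k 𝒜) i f) = 0 := by
      refine hφ _ fun c hc => ?_
      rw [← dual_smul]
      refine huw _ ?_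
      have := mem_filt_succ.1 hc _ (hC.proj_perp hf1 i)
      rwa [filt_one hA hC] at this
    rw [sub_mul, map_sub, h1, sub_zero] at h2
    exact h2
  · intro f hf
    rw [← sum_proj (k := k) (dualGrading k 𝒜) f, map_sum]
    refine Finset.sum_eq_zero fun i _ => ?_
    rw [← one_mul (proj k (dualGrading k 𝒜) i f)]
    exact hf.2 1 i

/-- Each element of the bidual of `filt C 2` pulls back to a member of the finite dual. By
reflexivity it is evaluation at some `a`, and `a` lies in `filt C 2` because the pullback kills the
annihilator of that space. -/
theorem finiteDimensional_filt_two_of_isReflexive (hA : IsSuperCocommutative k 𝒜)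
    {C : Submodule (WithConv (A →ₗ[k] k)) A} (hC : IsGraded 𝒜 (C : Set A))
    (hfin : FiniteDimensional k (C.restrictScalars k)) (hr : IsReflexive k 𝒜) :
    FiniteDimensional k ((filt C 2).restrictScalars k) := by
  obtain ⟨e, -, he⟩ := hr
  refine finite_of_dual_eval_surjective k _ fun ψ => ?_
  let V := (filt C 2).restrictScalars k
  have hmem := mem_finiteDual_of_perp hA hC hfin (ψ ∘ₗ dualRestrict V) fun f hf => by
    rw [LinearMap.comp_apply, dualRestrict_eq_zero_iff.2 hf, map_zero]
  obtain ⟨a, ha⟩ := e.surjective ⟨_, hmem⟩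
  have hf : ∀ f : WithConv (A →ₗ[k] k), f.ofConv a = ψ (dualRestrict V f) := fun f => by
    rw [← he]
    exact LinearMap.congr_fun (congrArg Subtype.val ha) f
  have haV : a ∈ V := mem_of_forall_dual fun f hfV => by
    rw [hf, dualRestrict_eq_zero_iff.2 hfV, map_zero]
  refine ⟨⟨a, haV⟩, LinearMap.ext fun g => ?_⟩
  obtain ⟨f, rfl⟩ := dualRestrict_surjective V g
  exact hf f

end Reflexive

/-! ### A Hilbert basis theorem for a locally nilpotent central element -/

section FinitelyGenerated

variable {k : Type*} [Field k] {A : Type*} [AddCommGroup A] [Module k A] [Coalgebra k A]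

/-- All left ideals of the dual that contain the annihilator of `K` are finitely generated modulo
this annihilator. -/
def FGModPerp (K : Submodule k A) : Prop :=
  ∀ I : Ideal (WithConv (A →ₗ[k] k)), (∀ f : WithConv (A →ₗ[k] k),
    (∀ c ∈ K, f.ofConv c = 0) → f ∈ I) →
    ∃ s : Finset (WithConv (A →ₗ[k] k)), (∀ f ∈ s, f ∈ I) ∧
      ∀ f ∈ I, ∃ w ∈ Ideal.span (s : Set (WithConv (A →ₗ[k] k))), ∀ c ∈ K, (f - w).ofConv c = 0

theorem FGModPerp.of_finiteDimensional (K : Submodule k A) [FiniteDimensional k K] :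
    FGModPerp K := by
  intro I _
  obtain ⟨s, hsI, hs⟩ := exists_finset_span_mod_perp K (I.restrictScalars k)
  refine ⟨s, hsI, fun f hf => ?_⟩
  obtain ⟨w, hw, h⟩ := hs f hf
  exact ⟨w, Submodule.span_le_restrictScalars k _ _ hw, h⟩

/-- Power series in a locally nilpotent element of the dual converge. -/
theorem exists_powerSeries_sum {g : WithConv (A →ₗ[k] k)}
    (hnil : ∀ a : A, ∃ n : ℕ, g ^ n • a = 0) (C : ℕ → WithConv (A →ₗ[k] k)) :
    ∃ S : WithConv (A →ₗ[k] k), ∀ (a : A) (n : ℕ), g ^ n • a = 0 →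
      S.ofConv a = ∑ m ∈ Finset.range n, (C m).ofConv (g ^ m • a) := by
  choose N hN using hnil
  have hz : ∀ (a : A) (n m : ℕ), n ≤ m → g ^ n • a = 0 → g ^ m • a = 0 := by
    intro a n m hnm h
    obtain ⟨d, rfl⟩ := Nat.exists_eq_add_of_le' hnm
    rw [pow_add, mul_smul, h, smul_zero]
  have hmono : ∀ (a : A) (n m : ℕ), n ≤ m → g ^ n • a = 0 →
      ∑ i ∈ Finset.range n, (C i).ofConv (g ^ i • a) =
        ∑ i ∈ Finset.range m, (C i).ofConv (g ^ i • a) := by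
    intro a n m hnm h
    refine Finset.sum_subset (Finset.range_mono hnm) fun i _ hi => ?_
    rw [hz a n i (by simpa using hi) h, map_zero]
  have hany : ∀ (a : A) (n m : ℕ), g ^ n • a = 0 → g ^ m • a = 0 →
      ∑ i ∈ Finset.range n, (C i).ofConv (g ^ i • a) =
        ∑ i ∈ Finset.range m, (C i).ofConv (g ^ i • a) := by
    intro a n m hn hm
    rcases le_total n m with h | h
    · exact hmono a n m h hn
    · exact (hmono a m n h hm).symm
  -- The series `∑ C m * g ^ m` is finite at each `a`. The chosen exponent `N a` is immaterial by
  -- `hany`, so linearity can be checked at a common exponent.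
  refine ⟨WithConv.toConv
    { toFun := fun a => ∑ i ∈ Finset.range (N a), (C i).ofConv (g ^ i • a)
      map_add' := fun a b => ?_
      map_smul' := fun r a => ?_ }, fun a n hn => hany a _ n (hN a) hn⟩
  · have ha := hz a _ (N a + N b) (Nat.le_add_right _ _) (hN a)
    have hb := hz b _ (N a + N b) (Nat.le_add_left _ _) (hN b)
    rw [hany a _ _ (hN a) ha, hany b _ _ (hN b) hb,
      hany (a + b) _ (N a + N b) (hN _) (by rw [smul_add, ha, hb, add_zero]),
      ← Finset.sum_add_distrib]
    exact Finset.sum_congr rfl fun i _ => by rw [smul_add, map_add]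
  · rw [hany (r • a) _ (N a) (hN _) (by rw [smul_comm, hN, smul_zero]), RingHom.id_apply,
      Finset.smul_sum]
    exact Finset.sum_congr rfl fun i _ => by rw [smul_comm, map_smul]

/-- A functional vanishing on `K ∩ ker g` lies in `K^⊥ + A* g`. -/
theorem exists_sub_mul_perp {K : Submodule k A} {g h : WithConv (A →ₗ[k] k)}
    (hh : ∀ a ∈ K, g • a = 0 → h.ofConv a = 0) :
    ∃ w : WithConv (A →ₗ[k] k), ∀ c ∈ K, (h - w * g).ofConv c = 0 := by
  let φ : K →ₗ[k] A := dualAct g ∘ₗ K.subtype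
  have hmem : h.ofConv ∘ₗ K.subtype ∈ LinearMap.range φ.dualMap := by
    rw [LinearMap.range_dualMap_eq_dualAnnihilator_ker, Submodule.mem_dualAnnihilator]
    exact fun a ha => hh a a.2 ha
  obtain ⟨ψ, hψ⟩ := hmem
  refine ⟨WithConv.toConv ψ, fun c hc => ?_⟩
  have h1 : ψ (g • c) = h.ofConv c := LinearMap.congr_fun hψ ⟨c, hc⟩
  rw [WithConv.ofConv_sub, LinearMap.sub_apply, ← dual_smul, sub_eq_zero]
  exact h1.symm

/-- The coefficients of order `j` of a left ideal with respect to a central element. -/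
def leadingIdeal (g : WithConv (A →ₗ[k] k)) (I : Ideal (WithConv (A →ₗ[k] k))) (j : ℕ) :
    Ideal (WithConv (A →ₗ[k] k)) where
  carrier := {f | ∃ r, f * g ^ j - r * g ^ (j + 1) ∈ I}
  add_mem' := by
    rintro x y ⟨r, hr⟩ ⟨r', hr'⟩
    refine ⟨r + r', ?_⟩
    convert I.add_mem hr hr' using 1
    noncomm_ring
  zero_mem' := ⟨0, by simp⟩
  smul_mem' := by
    rintro u x ⟨r, hr⟩
    refine ⟨u * r, ?_⟩
    convert I.mul_mem_left u hr using 1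
    rw [smul_eq_mul, mul_sub, mul_assoc, mul_assoc]

theorem mem_leadingIdeal {g : WithConv (A →ₗ[k] k)} {I : Ideal (WithConv (A →ₗ[k] k))} {j : ℕ}
    {f : WithConv (A →ₗ[k] k)} :
    f ∈ leadingIdeal g I j ↔ ∃ r, f * g ^ j - r * g ^ (j + 1) ∈ I := Iff.rfl

theorem leadingIdeal_mono {g : WithConv (A →ₗ[k] k)} (hg : ∀ u, u * g = g * u)
    (I : Ideal (WithConv (A →ₗ[k] k))) : Monotone (leadingIdeal g I) := by
  refine monotone_nat_of_le_succ fun j f => ?_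
  rintro ⟨r, hr⟩
  refine ⟨r, ?_⟩
  convert I.mul_mem_left g hr using 1
  rw [← hg, sub_mul, mul_assoc, mul_assoc, ← pow_succ, ← pow_succ]

theorem pow_smul_mem {K : Submodule k A} {g : WithConv (A →ₗ[k] k)} (hK : ∀ c ∈ K, g • c ∈ K)
    (n : ℕ) : ∀ c ∈ K, g ^ n • c ∈ K := by
  induction n with
  | zero =>
    intro c hc
    rwa [pow_zero, one_smul]
  | succ n ih =>
    intro c hc
    rw [pow_succ, mul_smul]
    exact ih _ (hK c hc)

/-- One step of successive approximation: modulo the annihilator of `K`, an element `r * g ^ (j +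
m)` of `I` is a combination of the lifts `u * g ^ j - ρ u * g ^ (j + 1)` plus a remainder in `I` of
higher order in `g`. -/
theorem exists_coeff {K : Submodule k A} {g : WithConv (A →ₗ[k] k)} (hg : ∀ u, u * g = g * u)
    (hK : ∀ c ∈ K, g • c ∈ K) {I : Ideal (WithConv (A →ₗ[k] k))}
    (hI : ∀ f : WithConv (A →ₗ[k] k), (∀ c ∈ K, f.ofConv c = 0) → f ∈ I) {j m : ℕ}
    {s : Finset (WithConv (A →ₗ[k] k))} {ρ : WithConv (A →ₗ[k] k) → WithConv (A →ₗ[k] k)}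
    (hρ : ∀ u ∈ s, u * g ^ j - ρ u * g ^ (j + 1) ∈ I)
    (hs : ∀ f ∈ leadingIdeal g I (j + m), ∃ w ∈ Ideal.span (s : Set (WithConv (A →ₗ[k] k))),
      ∀ c ∈ K, g • c = 0 → (f - w).ofConv c = 0)
    {r : WithConv (A →ₗ[k] k)} (hr : r * g ^ (j + m) ∈ I) :
    ∃ (c : WithConv (A →ₗ[k] k) → WithConv (A →ₗ[k] k)) (z : WithConv (A →ₗ[k] k)),
      z * g ^ (j + (m + 1)) ∈ I ∧ ∀ x ∈ K, (r * g ^ (j + m) -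
        ∑ u ∈ s, c u * g ^ m * (u * g ^ j - ρ u * g ^ (j + 1)) -
          z * g ^ (j + (m + 1))).ofConv x = 0 := by
  have hgn : ∀ (n : ℕ) u, u * g ^ n = g ^ n * u := fun n u =>
    ((show Commute u g from hg u).pow_right n).eq
  have hKn := pow_smul_mem hK
  -- The correction term is `0`: `r` is the leading coefficient of `r * g ^ (j + m)`, which lies in
  -- `I`.
  obtain ⟨w, hw, hrw⟩ := hs r ⟨0, by rwa [zero_mul, sub_zero]⟩
  obtain ⟨v, hv⟩ := exists_sub_mul_perp hrw
  obtain ⟨c, hc⟩ := Submodule.mem_span_finset'.1 hw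
  classical
  let c' : WithConv (A →ₗ[k] k) → WithConv (A →ₗ[k] k) := fun u =>
    if hu : u ∈ s then c ⟨u, hu⟩ else 0
  have hc' : w = ∑ u ∈ s, c' u * u := by
    rw [← hc, ← Finset.sum_coe_sort s]
    exact Finset.sum_congr rfl fun u _ => by simp [c']
  -- Two terms have order `j + m + 1`: the tails `ρ u` of the lifts, and `v`, from `r - w` agreeing
  -- with `v * g` on `K`.
  let z := ∑ u ∈ s, c' u * ρ u + v
  have key : r * g ^ (j + m) - ∑ u ∈ s, c' u * g ^ m * (u * g ^ j - ρ u * g ^ (j + 1)) -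
      z * g ^ (j + (m + 1)) = (r - w - v * g) * g ^ (j + m) := by
    have h1 : ∑ u ∈ s, c' u * g ^ m * (u * g ^ j - ρ u * g ^ (j + 1)) =
        w * g ^ (j + m) - (∑ u ∈ s, c' u * ρ u) * g ^ (j + (m + 1)) := by
      rw [hc', Finset.sum_mul, Finset.sum_mul, ← Finset.sum_sub_distrib]
      refine Finset.sum_congr rfl fun u _ => ?_
      rw [mul_assoc (c' u), mul_sub, ← mul_assoc (g ^ m), ← mul_assoc (g ^ m), ← hgn, ← hgn,
        mul_sub, mul_assoc u, mul_assoc (ρ u), ← pow_add, ← pow_add, mul_assoc, mul_assoc,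
        add_comm m j, show m + (j + 1) = j + (m + 1) by ring]
    rw [h1]
    simp only [z, add_mul, sub_mul, mul_assoc, ← pow_succ', add_assoc]
    abel
  have hperp : ∀ x ∈ K, (r * g ^ (j + m) -
      ∑ u ∈ s, c' u * g ^ m * (u * g ^ j - ρ u * g ^ (j + 1)) -
        z * g ^ (j + (m + 1))).ofConv x = 0 := by
    intro x hx
    rw [key, ← dual_smul]
    exact hv _ (hKn _ x hx)
  refine ⟨c', z, ?_, hperp⟩
  have h1 := hI _ hperp
  have h2 : ∑ u ∈ s, c' u * g ^ m * (u * g ^ j - ρ u * g ^ (j + 1)) ∈ I :=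
    Ideal.sum_mem _ fun u hu => I.mul_mem_left _ (hρ u hu)
  have h3 := I.sub_mem (I.sub_mem hr h2) h1
  rwa [sub_sub_cancel] at h3

/-- Finite generation lifts along a locally nilpotent central element. -/
theorem FGModPerp.of_inf_ker {K : Submodule k A} {g : WithConv (A →ₗ[k] k)}
    (hg : ∀ u, u * g = g * u) (hK : ∀ c ∈ K, g • c ∈ K)
    (hnil : ∀ a : A, ∃ n : ℕ, g ^ n • a = 0)
    (h : FGModPerp (K ⊓ LinearMap.ker (dualAct g : A →ₗ[k] A))) : FGModPerp K := by
  classical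
  intro I hI
  have hgn : ∀ (n : ℕ) u, u * g ^ n = g ^ n * u := fun n u =>
    ((show Commute u g from hg u).pow_right n).eq
  have hKn := pow_smul_mem hK
  have hL : ∀ j, ∀ f : WithConv (A →ₗ[k] k),
      (∀ c ∈ K ⊓ LinearMap.ker (dualAct g : A →ₗ[k] A), f.ofConv c = 0) →
      f ∈ leadingIdeal g I j := by
    intro j f hf
    obtain ⟨w, hw⟩ := exists_sub_mul_perp (K := K) (g := g) (h := f) fun a ha h0 => hf a ⟨ha, h0⟩
    refine ⟨w, hI _ fun c hc => ?_⟩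
    rw [pow_succ', ← mul_assoc, ← sub_mul, ← dual_smul]
    exact hw _ (hKn j c hc)
  have hgen : ∀ j, ∃ s : Finset (WithConv (A →ₗ[k] k)), (∀ f ∈ s, f ∈ leadingIdeal g I j) ∧
      ∀ f ∈ leadingIdeal g I j, ∃ w ∈ Ideal.span (s : Set (WithConv (A →ₗ[k] k))),
        ∀ c ∈ K, g • c = 0 → (f - w).ofConv c = 0 := by
    intro j
    obtain ⟨s, hs, hs'⟩ := h _ (hL j)
    refine ⟨s, hs, fun f hf => ?_⟩
    obtain ⟨w, hw, hfw⟩ := hs' f hf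
    exact ⟨w, hw, fun c hc h0 => hfw c ⟨hc, h0⟩⟩
  -- The union of the increasing leading ideals has finitely many generators modulo the annihilator,
  -- and these already lie in a single stage `j`; they serve all later stages.
  have hstab : ∃ (j : ℕ) (s : Finset (WithConv (A →ₗ[k] k))),
      (∀ f ∈ s, f ∈ leadingIdeal g I j) ∧
      ∀ m, ∀ f ∈ leadingIdeal g I (j + m), ∃ w ∈ Ideal.span (s : Set (WithConv (A →ₗ[k] k))),
        ∀ c ∈ K, g • c = 0 → (f - w).ofConv c = 0 := by
    obtain ⟨s, hs, hs'⟩ := h (⨆ j, leadingIdeal g I j) fun f hf =>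
      Submodule.mem_iSup_of_mem 0 (hL 0 f hf)
    have hdir := (leadingIdeal_mono hg I).directed_le
    choose! N hN using fun f hf => (Submodule.mem_iSup_of_directed _ hdir).1 (hs f hf)
    refine ⟨s.sup N, s, fun f hf => leadingIdeal_mono hg I (Finset.le_sup hf) (hN f hf),
      fun m f hf => ?_⟩
    obtain ⟨w, hw, hfw⟩ := hs' f (Submodule.mem_iSup_of_mem _ hf)
    exact ⟨w, hw, fun c hc h0 => hfw c ⟨hc, h0⟩⟩
  -- `S j` says that the elements of `I` of the form `r * g ^ j` are covered, modulo the annihilator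
  -- of `K`, by finitely many elements of `I`. It is proved for the stable stage by a convergent
  -- series, then brought down to `S 0`, the claim.
  let S : ℕ → Prop := fun j => ∃ T : Finset (WithConv (A →ₗ[k] k)), (∀ f ∈ T, f ∈ I) ∧
    ∀ r, r * g ^ j ∈ I → ∃ w ∈ Ideal.span (T : Set (WithConv (A →ₗ[k] k))),
      ∀ c ∈ K, (r * g ^ j - w).ofConv c = 0
  have hstep : ∀ j, S (j + 1) → S j := by
    rintro j ⟨T, hT, hT'⟩
    obtain ⟨s, hs, hs'⟩ := hgen j
    choose! ρ hρ using fun f hf => mem_leadingIdeal.1 (hs f hf)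
    refine ⟨T ∪ s.image fun u => u * g ^ j - ρ u * g ^ (j + 1), ?_, fun r hr => ?_⟩
    · intro f hf
      rcases Finset.mem_union.1 hf with hf | hf
      · exact hT f hf
      · obtain ⟨u, hu, rfl⟩ := Finset.mem_image.1 hf
        exact hρ u hu
    · obtain ⟨c, z, hz, hx⟩ := exists_coeff hg hK hI (m := 0) hρ hs' hr
      obtain ⟨w, hw, hzw⟩ := hT' z hz
      refine ⟨∑ u ∈ s, c u * g ^ 0 * (u * g ^ j - ρ u * g ^ (j + 1)) + w, ?_, fun y hy => ?_⟩
      · refine Ideal.add_mem _ (Ideal.sum_mem _ fun u hu => Ideal.mul_mem_left _ _ ?_)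
          (Ideal.span_mono (by simp) hw)
        exact Ideal.subset_span (by
          rw [Finset.mem_coe, Finset.mem_union]
          exact Or.inr (Finset.mem_image_of_mem _ hu))
      · have h1 := hx y hy
        have h2 := hzw y hy
        simp only [WithConv.ofConv_sub, WithConv.ofConv_add, LinearMap.sub_apply,
          LinearMap.add_apply, add_zero, zero_add] at h1 h2 ⊢
        linear_combination h1 + h2
  have hbase : ∃ j, S j := by
    obtain ⟨j, s, hs, hs'⟩ := hstab
    choose! ρ hρ using fun f hf => mem_leadingIdeal.1 (hs f hf)
    refine ⟨j, s.image fun u => u * g ^ j - ρ u * g ^ (j + 1), ?_, fun r hr => ?_⟩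
    · intro f hf
      obtain ⟨u, hu, rfl⟩ := Finset.mem_image.1 hf
      exact hρ u hu
    · choose c z hz hx using fun (m : ℕ) (r : {r // r * g ^ (j + m) ∈ I}) =>
        exists_coeff hg hK hI (m := m) hρ (hs' m) r.2
      -- `q m` is the coefficient of the remainder after `m` approximations; collecting the
      -- coefficients of each lift over all `m` gives the power series `F u`.
      let q : (m : ℕ) → {r // r * g ^ (j + m) ∈ I} := fun m =>
        Nat.rec ⟨r, hr⟩ (fun m p => ⟨z m p, hz m p⟩) m
      have hq0 : (q 0).1 = r := rfl
      have hq : ∀ m, (q (m + 1)).1 = z m (q m) := fun _ => rfl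
      choose F hF using fun u => exists_powerSeries_sum hnil fun m => c m (q m) u
      refine ⟨∑ u ∈ s, F u * (u * g ^ j - ρ u * g ^ (j + 1)),
        Ideal.sum_mem _ fun u hu => Ideal.mul_mem_left _ _ (Ideal.subset_span
          (Finset.mem_coe.2 (Finset.mem_image_of_mem _ hu))), fun y hy => ?_⟩
      have htel : ∀ N : ℕ, (r * g ^ j).ofConv y = ∑ m ∈ Finset.range N, (∑ u ∈ s,
          c m (q m) u * g ^ m * (u * g ^ j - ρ u * g ^ (j + 1))).ofConv y +
            ((q N).1 * g ^ (j + N)).ofConv y := by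
        intro N
        induction N with
        | zero => simp [hq0]
        | succ N ih =>
          have h1 := hx N (q N) y hy
          rw [← hq] at h1
          rw [ih, Finset.sum_range_succ]
          simp only [WithConv.ofConv_sub, LinearMap.sub_apply] at h1 ⊢
          linear_combination h1
      -- At a given `y` a power `g ^ N` acts as zero, so both the remainder and the tails of the
      -- series vanish there.
      obtain ⟨N, hN⟩ := hnil y
      have hlast : ((q N).1 * g ^ (j + N)).ofConv y = 0 := by
        have h0 : g ^ (j + N) • y = 0 := by rw [pow_add, mul_smul, hN, smul_zero]
        rw [← dual_smul, h0, map_zero]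
      rw [WithConv.ofConv_sub, LinearMap.sub_apply, htel N, hlast, add_zero, sub_eq_zero]
      simp only [WithConv.ofConv_sum, LinearMap.sum_apply]
      rw [Finset.sum_comm]
      refine Finset.sum_congr rfl fun u _ => ?_
      rw [← dual_smul, hF u _ N]
      · refine Finset.sum_congr rfl fun m _ => ?_
        rw [dual_smul, dual_smul, mul_assoc]
      · rw [← mul_smul, ← hgn, mul_smul, hN, smul_zero]
  have hzero : ∀ j, S j → S 0 := by
    intro j
    induction j with
    | zero => exact id
    | succ j ih => exact fun hj => ih (hstep j hj)
  obtain ⟨j, hj⟩ := hbase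
  obtain ⟨T, hT, hT'⟩ := hzero j hj
  refine ⟨T, hT, fun f hf => ?_⟩
  have := hT' f (by rwa [pow_zero, mul_one])
  rwa [pow_zero, mul_one] at this

end FinitelyGenerated

/-! ### Finite type implies Noetherian -/

section Noetherian

variable {k : Type*} [Field k] {A : Type*} [AddCommGroup A] [Module k A] [Coalgebra k A]
  {𝒜 : ZMod 2 → Submodule k A} [DirectSum.Decomposition 𝒜] [IsSuperCoalgebra k 𝒜]

/-- The elements of `K` killed by all elements of `T`. -/
def kerIn (K : Submodule k A) (T : Finset (WithConv (A →ₗ[k] k))) : Submodule k A where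
  carrier := {a | a ∈ K ∧ ∀ g ∈ T, g • a = 0}
  add_mem' := fun {a b} ha hb => ⟨K.add_mem ha.1 hb.1, fun g hg => by
    rw [smul_add, ha.2 g hg, hb.2 g hg, add_zero]⟩
  zero_mem' := ⟨K.zero_mem, fun g _ => smul_zero g⟩
  smul_mem' := fun r a ha => ⟨K.smul_mem r ha.1, fun g hg => by
    rw [smul_comm, ha.2 g hg, smul_zero]⟩

theorem mem_kerIn {K : Submodule k A} {T : Finset (WithConv (A →ₗ[k] k))} {a : A} :
    a ∈ kerIn K T ↔ a ∈ K ∧ ∀ g ∈ T, g • a = 0 := Iff.rfl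

theorem kerIn_empty (K : Submodule k A) : kerIn K ∅ = K := by
  ext a
  simp [mem_kerIn]

theorem smul_mem_kerIn_singleton (hA : IsSuperCocommutative k 𝒜) {K : Submodule k A}
    (hK : ∀ f : WithConv (A →ₗ[k] k), ∀ a ∈ K, f • a ∈ K) {j : ZMod 2}
    {g : WithConv (A →ₗ[k] k)} (hg : g ∈ dualGrading k 𝒜 j) (f : WithConv (A →ₗ[k] k)) :
    ∀ a ∈ kerIn K {g}, f • a ∈ kerIn K {g} := by
  intro a ha
  refine ⟨hK f a ha.1, fun g' hg' => ?_⟩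
  obtain rfl := Finset.mem_singleton.1 hg'
  obtain ⟨f', e, -⟩ := exists_mul_eq_mul_left hA hg f
  rw [← mul_smul, e, mul_smul, ha.2 g' hg', smul_zero]

theorem kerIn_kerIn [DecidableEq (WithConv (A →ₗ[k] k))] (K : Submodule k A)
    (S T : Finset (WithConv (A →ₗ[k] k))) :
    kerIn (kerIn K S) T = kerIn K (S ∪ T) := by
  ext a
  simp only [mem_kerIn, Finset.mem_union, or_imp, forall_and, and_assoc]

theorem FGModPerp.of_kerIn (hA : IsSuperCocommutative k 𝒜) (T : Finset (WithConv (A →ₗ[k] k)))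
    (hT : ∀ g ∈ T, g ∈ dualGrading k 𝒜 0 ∧ ∀ a : A, ∃ n : ℕ, g ^ n • a = 0)
    (K : Submodule k A) (hK : ∀ f : WithConv (A →ₗ[k] k), ∀ a ∈ K, f • a ∈ K)
    (h : FGModPerp (kerIn K T)) : FGModPerp K := by
  classical
  induction T using Finset.induction_on generalizing K with
  | empty =>
    rwa [kerIn_empty] at h
  | insert g T _ ih =>
    have hg := hT g (Finset.mem_insert_self _ _)
    refine FGModPerp.of_inf_ker (mul_comm_of_even hA hg.1) (hK g) hg.2 ?_
    have e : K ⊓ LinearMap.ker (dualAct g : A →ₗ[k] A) = kerIn K {g} := by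
      ext a
      simp [mem_kerIn, dualAct_apply]
    rw [e]
    refine ih (fun g' hg' => hT g' (Finset.mem_insert_of_mem hg')) _
      (smul_mem_kerIn_singleton hA hK hg.1) ?_
    rwa [kerIn_kerIn, ← Finset.insert_eq]

/-- For odd `g` the relation `g * g = 0` means that `g` maps `K` into its own kernel in `K`, so `K`
is finite-dimensional as soon as this kernel is. The members of `T` are removed one by one. -/
theorem finiteDimensional_of_kerIn_odd (hk : ringChar k ≠ 2) (hA : IsSuperCocommutative k 𝒜)
    (T : Finset (WithConv (A →ₗ[k] k))) (hT : ∀ g ∈ T, g ∈ dualGrading k 𝒜 1)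
    (K : Submodule k A) (hK : ∀ f : WithConv (A →ₗ[k] k), ∀ a ∈ K, f • a ∈ K)
    (h : FiniteDimensional k (kerIn K T)) : FiniteDimensional k K := by
  classical
  induction T using Finset.induction_on generalizing K with
  | empty =>
    rwa [kerIn_empty] at h
  | insert g T _ ih =>
    have hg := hT g (Finset.mem_insert_self _ _)
    have hfin : FiniteDimensional k (kerIn K {g}) := by
      refine ih (fun g' hg' => hT g' (Finset.mem_insert_of_mem hg')) _
        (smul_mem_kerIn_singleton hA hK hg) ?_
      rwa [kerIn_kerIn, ← Finset.insert_eq]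
    let φ : K →ₗ[k] kerIn K {g} := (dualAct g ∘ₗ K.subtype).codRestrict _ fun a =>
      ⟨hK g a a.2, fun g' hg' => by
        obtain rfl := Finset.mem_singleton.1 hg'
        change g' • g' • (a : A) = 0
        rw [← mul_smul, mul_self_of_odd hk hA hg]
        exact zero_smul (WithConv (A →ₗ[k] k)) (a : A)⟩
    have hker : FiniteDimensional k (LinearMap.ker φ) := by
      let e : LinearMap.ker φ →ₗ[k] kerIn K {g} :=
        (K.subtype ∘ₗ (LinearMap.ker φ).subtype).codRestrict _ fun a =>
          ⟨a.1.2, fun g' hg' => by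
            obtain rfl := Finset.mem_singleton.1 hg'
            exact congrArg Subtype.val a.2⟩
      refine FiniteDimensional.of_injective e fun x y hxy => ?_
      have h := congrArg Subtype.val hxy
      exact Subtype.ext (Subtype.ext h)
    have hq := Module.Finite.equiv φ.quotKerEquivRange.symm
    exact Module.Finite.of_submodule_quotient (LinearMap.ker φ)

theorem exists_pow_smul_eq_zero_of_perp (hA : IsSuperCocommutative k 𝒜)
    {g : WithConv (A →ₗ[k] k)} (hg : ∀ c ∈ coradMod 𝒜, g.ofConv c = 0) (a : A) :
    ∃ n : ℕ, g ^ n • a = 0 := by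
  obtain ⟨n, hn⟩ := exists_mem_filt hA a
  refine ⟨n, ?_⟩
  induction n generalizing a with
  | zero =>
    rw [pow_zero, one_smul]
    exact hn
  | succ n ih =>
    rw [pow_succ, mul_smul]
    exact ih _ (mem_filt_succ.1 hn g hg)

/-- The dual of a super-coalgebra of finite type is Noetherian. -/
theorem isNoetherianRing_dual (hk : ringChar k ≠ 2) (hA : IsSuperCocommutative k 𝒜)
    (hfin : FiniteDimensional k ((filt (coradMod 𝒜) 2).restrictScalars k)) :
    IsNoetherianRing (WithConv (A →ₗ[k] k)) := by
  classical
  obtain ⟨G, hG, hgen⟩ := exists_homogeneous_generators (isGraded_coradMod 𝒜) hfin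
  let Ge := G.filter (· ∈ dualGrading k 𝒜 0)
  let Go := G.filter (· ∈ dualGrading k 𝒜 1)
  have hU : Ge ∪ Go = G := by
    rw [← Finset.filter_or, Finset.filter_eq_self]
    intro g hg
    obtain ⟨j, hj⟩ := (hG g hg).2
    fin_cases j
    · exact Or.inl hj
    · exact Or.inr hj
  -- An element killed by all generators lies in the first term of the filtration, by the membership
  -- test with `n = 0`.
  have hle : kerIn ⊤ G ≤ (filt (coradMod 𝒜) 2).restrictScalars k := by
    intro a ha
    obtain ⟨m, hm⟩ := exists_mem_filt hA a
    refine filt_mono (by omega : 0 + 1 ≤ 2) (hgen.mem_filt_of_mem hA (isGraded_coradMod 𝒜) hm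
      fun g hg => ?_)
    rw [ha.2 g hg]
    exact Submodule.zero_mem _
  have hfin1 : FiniteDimensional k (kerIn ⊤ G) := Submodule.finiteDimensional_of_le hle
  have hstable : ∀ T : Finset (WithConv (A →ₗ[k] k)), (∀ g ∈ T, g ∈ dualGrading k 𝒜 0) →
      ∀ f : WithConv (A →ₗ[k] k), ∀ a ∈ kerIn (⊤ : Submodule k A) T, f • a ∈ kerIn ⊤ T := by
    intro T hT f a ha
    refine ⟨trivial, fun g hg => ?_⟩
    rw [← mul_smul, ← mul_comm_of_even hA (hT g hg), mul_smul, ha.2 g hg, smul_zero]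
  -- The odd generators must go first: what remains are central elements, along which finite
  -- generation lifts.
  have hfin2 : FiniteDimensional k (kerIn (⊤ : Submodule k A) Ge) := by
    refine finiteDimensional_of_kerIn_odd hk hA Go (fun g hg => (Finset.mem_filter.1 hg).2) _
      (hstable Ge fun g hg => (Finset.mem_filter.1 hg).2) ?_
    rwa [kerIn_kerIn, hU]
  have hFG : FGModPerp (⊤ : Submodule k A) :=
    FGModPerp.of_kerIn hA Ge (fun g hg => ⟨(Finset.mem_filter.1 hg).2,
      exists_pow_smul_eq_zero_of_perp hA (hG g (Finset.mem_filter.1 hg).1).1⟩) ⊤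
      (fun _ _ _ => trivial) (FGModPerp.of_finiteDimensional _)
  refine ⟨fun I => ?_⟩
  obtain ⟨s, hs, hs'⟩ := hFG I fun f hf => by
    have : f = 0 := WithConv.ext (LinearMap.ext fun a => hf a trivial)
    rw [this]
    exact I.zero_mem
  refine ⟨s, le_antisymm (Ideal.span_le.2 hs) fun f hf => ?_⟩
  obtain ⟨w, hw, hfw⟩ := hs' f hf
  have : f - w = 0 := WithConv.ext (LinearMap.ext fun a => hfw a trivial)
  rwa [sub_eq_zero.1 this]

end Noetherian

theorem proj_add_proj {k : Type*} [Field k] {V : Type*} [AddCommGroup V] [Module k V]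
    (𝒱 : ZMod 2 → Submodule k V) [DirectSum.Decomposition 𝒱] (v : V) :
    proj k 𝒱 0 v + proj k 𝒱 1 v = v :=
  (Fin.sum_univ_two fun i : ZMod 2 => proj k 𝒱 i v).symm.trans (sum_proj 𝒱 v)

/-! ### Artinian modules and finite generation -/

section Artinian

variable {R : Type*} [Ring R] {M : Type*} [AddCommGroup M] [Module R M]

theorem fg_of_isSemisimpleModule_of_isArtinian [IsArtinian R M] (C : Submodule R M)
    [IsSemisimpleModule R C] : C.FG := by
  rw [← Module.Finite.iff_fg]
  have h := IsSemisimpleModule.finite_tfae (R := R) (M := C)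
  have h02 : Module.Finite R C ↔ IsArtinian R C := h.out 0 2
  exact h02.2 inferInstance

/-- Hopkins–Levitzki: `F / C` is an Artinian module over the Artinian ring `R ⧸ J`, hence Noetherian
and finitely generated. -/
theorem fg_of_isArtinian [IsArtinian R M] {C F : Submodule R M} (hCF : C ≤ F) (hC : C.FG)
    (J : Ideal R) [J.IsTwoSided] [IsArtinianRing (R ⧸ J)] (hJ : ∀ f ∈ J, ∀ x ∈ F, f • x ∈ C) :
    F.FG := by
  let N : Submodule R F := C.comap F.subtype
  have htor : Module.IsTorsionBySet R (F ⧸ N) J := by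
    rintro q ⟨f, hf⟩
    obtain ⟨x, rfl⟩ := N.mkQ_surjective q
    exact (Submodule.Quotient.mk_eq_zero N).2 (hJ f hf x x.2)
  let hmod := htor.module
  have hQart : IsArtinian (R ⧸ J) (F ⧸ N) := isArtinian_of_tower R inferInstance
  have hQnoeth : IsNoetherian (R ⧸ J) (F ⧸ N) :=
    IsSemiprimaryRing.isNoetherian_iff_isArtinian.2 hQart
  have hQfin : Module.Finite R (F ⧸ N) := Module.Finite.trans (R ⧸ J) (F ⧸ N)
  have hC' : Module.Finite R C := Module.Finite.iff_fg.2 hC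
  have hNfin : Module.Finite R N := Module.Finite.equiv (Submodule.comapSubtypeEquivOfLe hCF).symm
  exact Module.Finite.iff_fg.1 (Module.Finite.of_submodule_quotient N)

end Artinian

/-! ### Chain conditions and local finiteness -/

section ChainConditions

variable {k : Type*} [Field k] {A : Type*} [AddCommGroup A] [Module k A] [Coalgebra k A]
  {𝒜 : ZMod 2 → Submodule k A} [DirectSum.Decomposition 𝒜] [IsSuperCoalgebra k 𝒜]

theorem isNoetherianSuper_of_isNoetherianRing {R : Type*} [Ring R] [Algebra k R]
    (𝓡 : ZMod 2 → Submodule k R) [GradedAlgebra 𝓡] [IsNoetherianRing R] : IsNoetherianSuper 𝓡 := by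
  intro I _ hI
  obtain ⟨N, hN⟩ := monotone_stabilizes_iff_noetherian.2 (inferInstanceAs (IsNoetherian R R))
    ⟨I, monotone_nat_of_le_succ hI⟩
  exact ⟨N, fun n hn => (hN n hn).symm⟩

theorem subSuperCoalgebraDCC_of_isNoetherianSuper (hA : IsSuperCocommutative k 𝒜)
    (h : IsNoetherianSuper (dualGrading k 𝒜)) : SubSuperCoalgebraDCC k 𝒜 := by
  intro B hB hdec
  choose V hV hgr using fun n => (hB n).exists_submodule
  have hmem : ∀ n a, a ∈ V n ↔ a ∈ B n := fun n a => by rw [← hV n]; rfl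
  obtain ⟨N, hN⟩ := h (fun n => perpIdeal hA (V n) (hgr n))
    (fun n => isSuperideal_perpIdeal hA _ _)
    (fun n f hf a ha => hf a ((hmem n a).2 (hdec n ((hmem _ a).1 ha))))
  refine ⟨N, fun n hn => ?_⟩
  have hsub : ∀ m m', perpIdeal hA (V m) (hgr m) = perpIdeal hA (V m') (hgr m') → B m ≤ B m' := by
    intro m m' e a ha
    refine mem_of_forall_dual fun f hf => ?_
    have h1 : f ∈ perpIdeal hA (V m') (hgr m') := fun b hb => hf b ((hmem _ b).1 hb)
    rw [← e] at h1
    exact h1 a ((hmem _ a).2 ha)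
  exact le_antisymm (hsub _ _ (hN n hn)) (hsub _ _ (hN n hn).symm)

/-- The largest graded submodule of a submodule. -/
theorem exists_graded_core (V : Submodule (WithConv (A →ₗ[k] k)) A) :
    ∃ W : Submodule (WithConv (A →ₗ[k] k)) A, IsGraded 𝒜 (W : Set A) ∧
      ∀ a, a ∈ W ↔ ∀ i, proj k 𝒜 i a ∈ V := by
  refine ⟨
    { carrier := {a | ∀ i, proj k 𝒜 i a ∈ V}
      add_mem' := fun {a b} ha hb i => by
        rw [map_add]
        exact V.add_mem (ha i) (hb i)
      zero_mem' := fun i => by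
        rw [map_zero]
        exact V.zero_mem
      smul_mem' := fun u a ha n => by
        rw [proj_smul]
        exact V.sum_mem fun j _ => V.smul_mem _ (ha _) }, ?_, fun _ => Iff.rfl⟩
  intro i a ha n
  by_cases h : i = n
  · subst h
    rw [proj_of_mem 𝒜 (proj_mem 𝒜 i a)]
    exact ha i
  · rw [proj_of_mem_ne 𝒜 h (proj_mem 𝒜 i a)]
    exact V.zero_mem

/-- The smallest graded submodule containing a submodule. -/
theorem exists_graded_hull (V : Submodule (WithConv (A →ₗ[k] k)) A) :
    ∃ W : Submodule (WithConv (A →ₗ[k] k)) A, IsGraded 𝒜 (W : Set A) ∧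
      ∀ a, a ∈ W ↔ ∃ v ∈ V, ∃ w ∈ V, proj k 𝒜 0 v + proj k 𝒜 1 w = a := by
  refine ⟨
    { carrier := {a | ∃ v ∈ V, ∃ w ∈ V, proj k 𝒜 0 v + proj k 𝒜 1 w = a}
      add_mem' := ?_
      zero_mem' := ⟨0, V.zero_mem, 0, V.zero_mem, by simp⟩
      smul_mem' := ?_ }, ?_, fun _ => Iff.rfl⟩
  · rintro _ _ ⟨v, hv, w, hw, rfl⟩ ⟨v', hv', w', hw', rfl⟩
    refine ⟨v + v', V.add_mem hv hv', w + w', V.add_mem hw hw', ?_⟩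
    rw [map_add, map_add]
    abel
  · rintro u _ ⟨v, hv, w, hw, rfl⟩
    let u0 := proj k (dualGrading k 𝒜) 0 u
    let u1 := proj k (dualGrading k 𝒜) 1 u
    have e0 : ∀ n a, proj k 𝒜 n (u0 • a) = u0 • proj k 𝒜 (n + 0) a := fun n a =>
      proj_smul_of_mem (proj_mem _ 0 u) n a
    have e1 : ∀ n a, proj k 𝒜 n (u1 • a) = u1 • proj k 𝒜 (n + 1) a := fun n a =>
      proj_smul_of_mem (proj_mem _ 1 u) n a
    -- The odd part of `u` exchanges parities, so it moves contributions between the two witnesses.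
    refine ⟨u0 • v + u1 • w, V.add_mem (V.smul_mem _ hv) (V.smul_mem _ hw),
      u1 • v + u0 • w, V.add_mem (V.smul_mem _ hv) (V.smul_mem _ hw), ?_⟩
    have hu : u = u0 + u1 := (proj_add_proj (k := k) (dualGrading k 𝒜) u).symm
    rw [map_add, map_add, e0, e0, e1, e1, add_zero, add_zero, zero_add,
      show (1 + 1 : ZMod 2) = 0 from rfl, hu, add_smul, smul_add, smul_add]
    abel
  · rintro i _ ⟨v, hv, w, hw, rfl⟩
    have h01 : (0 : ZMod 2) ≠ 1 := by decide
    have hi : i = 0 ∨ i = 1 := by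
      revert i
      decide
    rcases hi with rfl | rfl
    · refine ⟨v, hv, 0, V.zero_mem, ?_⟩
      rw [map_add, proj_of_mem 𝒜 (proj_mem 𝒜 0 v), proj_of_mem_ne 𝒜 h01.symm (proj_mem 𝒜 1 w),
        map_zero]
    · refine ⟨0, V.zero_mem, w, hw, ?_⟩
      rw [map_add, proj_of_mem 𝒜 (proj_mem 𝒜 1 w), proj_of_mem_ne 𝒜 h01 (proj_mem 𝒜 0 v),
        map_zero]

/-- For a descending chain of arbitrary submodules, the graded cores `L` and the graded hulls `U`
both stabilise; when 2 is invertible, this forces the chain itself to stabilise. -/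
theorem isArtinian_of_dcc (hk : ringChar k ≠ 2) (hA : IsSuperCocommutative k 𝒜)
    (h : SubSuperCoalgebraDCC k 𝒜) : IsArtinian (WithConv (A →ₗ[k] k)) A := by
  rw [← monotone_stabilizes_iff_artinian]
  intro F
  let V : ℕ → Submodule (WithConv (A →ₗ[k] k)) A := fun n => OrderDual.ofDual (F n)
  have hV : ∀ m n, m ≤ n → V n ≤ V m := fun m n hmn => F.monotone hmn
  choose L hLgr hL using fun n => exists_graded_core (𝒜 := 𝒜) (V n)
  choose U hUgr hU using fun n => exists_graded_hull (𝒜 := 𝒜) (V n)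
  obtain ⟨N1, hN1⟩ := h (fun n => (L n).restrictScalars k)
    (fun n => (isSubSuperCoalgebra_iff hA).2 (hLgr n))
    (fun n a ha => (hL n a).2 fun i => hV n (n + 1) (Nat.le_succ n) ((hL _ a).1 ha i))
  obtain ⟨N2, hN2⟩ := h (fun n => (U n).restrictScalars k)
    (fun n => (isSubSuperCoalgebra_iff hA).2 (hUgr n))
    (fun n a ha => by
      obtain ⟨v, hv, w, hw, e⟩ := (hU _ a).1 ha
      exact (hU n a).2 ⟨v, hV n (n + 1) (Nat.le_succ n) hv, w, hV n (n + 1) (Nat.le_succ n) hw, e⟩)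
  refine ⟨max N1 N2, fun n hn => ?_⟩
  have hLn : ∀ a, a ∈ L (max N1 N2) → a ∈ L n := fun a ha => by
    have e : (L (max N1 N2)).restrictScalars k = (L n).restrictScalars k :=
      (hN1 _ (le_max_left _ _)).trans (hN1 n ((le_max_left _ _).trans hn)).symm
    have : a ∈ (L (max N1 N2)).restrictScalars k := ha
    rwa [e] at this
  have hUn : ∀ a, a ∈ U (max N1 N2) → a ∈ U n := fun a ha => by
    have e : (U (max N1 N2)).restrictScalars k = (U n).restrictScalars k :=
      (hN2 _ (le_max_right _ _)).trans (hN2 n ((le_max_right _ _).trans hn)).symm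
    have : a ∈ (U (max N1 N2)).restrictScalars k := ha
    rwa [e] at this
  have h2 : (2 : k) ≠ 0 := Ring.two_ne_zero hk
  have hsum : ∀ a, proj k 𝒜 0 a + proj k 𝒜 1 a = a := proj_add_proj (k := k) 𝒜
  have hsm : ∀ (W : Submodule (WithConv (A →ₗ[k] k)) A) (r : k) {a}, a ∈ W → r • a ∈ W :=
    fun W r _ ha => (W.restrictScalars k).smul_mem r ha
  suffices hle : V (max N1 N2) ≤ V n by
    have heq : V (max N1 N2) = V n := le_antisymm hle (hV _ _ hn)
    exact congrArg OrderDual.toDual heq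
  intro b hb
  obtain ⟨v, hv, w, hw, e⟩ := (hU n b).1 (hUn b ((hU _ b).2 ⟨b, hb, b, hb, hsum b⟩))
  -- From `b = v₀ + w₁` one gets `2b - (v + w) = d₀ - d₁`. Adding `d` puts `2d₀` in the earlier
  -- submodule, so `d` lies in its core. The core of the later submodule is the same, so that
  -- submodule contains `d₀` and `d₁`, and hence `2b`.
  let d := v - w
  have hd : d ∈ V n := (V n).sub_mem hv hw
  have hb2 : (2 : k) • b - (v + w) = proj k 𝒜 0 d - proj k 𝒜 1 d := by
    have hv' := hsum v
    have hw' := hsum w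
    rw [map_sub, map_sub, ← e]
    nth_rewrite 2 [← hv', ← hw']
    rw [two_smul]
    abel
  have hd2 : (2 : k) • proj k 𝒜 0 d = (2 : k) • b - (v + w) + d := by
    rw [hb2]
    nth_rewrite 4 [← hsum d]
    rw [two_smul]
    abel
  have hmax := hV _ _ hn
  have hp0 : proj k 𝒜 0 d ∈ V (max N1 N2) := by
    have h3 : (2 : k) • proj k 𝒜 0 d ∈ V (max N1 N2) := by
      rw [hd2]
      exact Submodule.add_mem _ (Submodule.sub_mem _ (hsm _ 2 hb)
        (Submodule.add_mem _ (hmax hv) (hmax hw))) (hmax hd)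
    have h4 := hsm _ (2⁻¹ : k) h3
    rwa [smul_smul, inv_mul_cancel₀ h2, one_smul] at h4
  have hp1 : proj k 𝒜 1 d ∈ V (max N1 N2) := by
    have : proj k 𝒜 1 d = d - proj k 𝒜 0 d := by
      rw [eq_sub_iff_add_eq, add_comm, hsum]
    rw [this]
    exact Submodule.sub_mem _ (hmax hd) hp0
  have hdL : d ∈ L (max N1 N2) := (hL _ d).2 fun i => by
    have hi : i = 0 ∨ i = 1 := by
      revert i
      decide
    rcases hi with rfl | rfl
    · exact hp0
    · exact hp1
  have hdLn := (hL n d).1 (hLn d hdL)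
  have h5 : (2 : k) • b ∈ V n := by
    have : (2 : k) • b = proj k 𝒜 0 d - proj k 𝒜 1 d + (v + w) := by
      rw [← hb2, sub_add_cancel]
    rw [this]
    exact Submodule.add_mem _ (Submodule.sub_mem _ (hdLn 0) (hdLn 1)) (Submodule.add_mem _ hv hw)
  have h6 := hsm _ (2⁻¹ : k) h5
  rwa [smul_smul, inv_mul_cancel₀ h2, one_smul] at h6

theorem finiteDimensional_of_fg {V : Submodule (WithConv (A →ₗ[k] k)) A} (hV : V.FG) :
    FiniteDimensional k (V.restrictScalars k) := by
  induction V, hV using Submodule.fg_induction with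
  | singleton x => exact finiteDimensional_orbit x
  | sup V W _ _ hV hW => exact finiteDimensional_sup hV hW

/-- The coradical is purely even, so all its submodules are graded; simple sub-super-coalgebras are
therefore simple as ungraded modules. -/
theorem isSemisimpleModule_coradMod (hk : ringChar k ≠ 2) (hA : IsSuperCocommutative k 𝒜) :
    IsSemisimpleModule (WithConv (A →ₗ[k] k)) (coradMod 𝒜) := by
  have key := isSemisimpleModule_biSup_of_isSemisimpleModule_submodule
    (R := WithConv (A →ₗ[k] k)) (M := A)
    (s := {V : Submodule (WithConv (A →ₗ[k] k)) A |
      IsSimpleSubSuperCoalgebra k 𝒜 (V.restrictScalars k)}) (p := fun V => V) ?_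
  · rw [coradMod, sSup_eq_iSup]
    exact key
  · intro V hV
    have : IsSimpleModule (WithConv (A →ₗ[k] k)) V := by
      rw [isSimpleModule_iff_isAtom]
      refine ⟨fun h => hV.2.1 (by rw [h]; rfl), fun W hW => ?_⟩
      have hWgr : IsGraded 𝒜 (W : Set A) := by
        intro i a ha
        have h0 := coradMod_le_even hk hA ((le_sSup hV : V ≤ coradMod 𝒜) (hW.le ha))
        by_cases hi : 0 = i
        · rw [← hi, proj_of_mem 𝒜 h0]
          exact ha
        · rw [proj_of_mem_ne 𝒜 hi h0]
          exact W.zero_mem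
      rcases hV.2.2 (W.restrictScalars k) ((isSubSuperCoalgebra_iff hA).2 hWgr) hW.le with h | h
      · exact (Submodule.restrictScalars_eq_bot_iff _ _ _).1 h
      · exact absurd (Submodule.restrictScalars_injective k _ _ h) hW.ne
    infer_instance

/-- The descending chain condition implies finite type. -/
theorem finiteDimensional_filt_two_of_dcc (hk : ringChar k ≠ 2) (hA : IsSuperCocommutative k 𝒜)
    (h : SubSuperCoalgebraDCC k 𝒜) :
    FiniteDimensional k ((filt (coradMod 𝒜) 2).restrictScalars k) := by
  have hart := isArtinian_of_dcc hk hA h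
  have hss := isSemisimpleModule_coradMod hk hA
  have hCfg : (coradMod 𝒜).FG := fg_of_isSemisimpleModule_of_isArtinian _
  have hCk : FiniteDimensional k ((coradMod 𝒜).restrictScalars k) := finiteDimensional_of_fg hCfg
  have hgr := isGraded_coradMod 𝒜
  have hJ : (perpIdeal hA (coradMod 𝒜) hgr).IsTwoSided := (isSuperideal_perpIdeal hA _ hgr).1
  have hSk := finiteDimensional_quotient_perpIdeal hA _ hgr hCk
  have hS : IsArtinianRing (WithConv (A →ₗ[k] k) ⧸ perpIdeal hA (coradMod 𝒜) hgr) :=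
    isArtinian_of_tower k inferInstance
  have hCF : coradMod 𝒜 ≤ filt (coradMod 𝒜) 2 := by
    have := filt_mono (C := coradMod 𝒜) (by omega : 1 ≤ 2)
    rwa [filt_one hA hgr] at this
  refine finiteDimensional_of_fg (fg_of_isArtinian hCF hCfg (perpIdeal hA (coradMod 𝒜) hgr) ?_)
  intro f hf x hx
  have := mem_filt_succ.1 hx f hf
  rwa [filt_one hA hgr] at this

/-- Super-coalgebras of finite type are locally finite. -/
theorem isLocallyFinite_of_finite (hA : IsSuperCocommutative k 𝒜)
    (hfin : FiniteDimensional k ((filt (coradMod 𝒜) 2).restrictScalars k)) :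
    IsLocallyFinite k 𝒜 := by
  intro X Y _ _ hX hY
  have hexh : ∀ Z : Submodule k A, FiniteDimensional k Z →
      ∃ n, Z ≤ (filt (coradMod 𝒜) n).restrictScalars k := by
    intro Z hZ
    obtain ⟨s, rfl⟩ := Module.Finite.iff_fg.1 hZ
    choose N hN using exists_mem_filt (𝒜 := 𝒜) hA
    exact ⟨s.sup N, Submodule.span_le.2 fun a ha => filt_mono (Finset.le_sup ha) (hN a)⟩
  obtain ⟨m, hm⟩ := hexh X hX
  obtain ⟨n, hn⟩ := hexh Y hY
  have := finiteDimensional_filt hA (isGraded_coradMod 𝒜) hfin (m + n)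
  refine Submodule.finiteDimensional_of_le (S₂ := (filt (coradMod 𝒜) (m + n)).restrictScalars k)
    fun a ha => ?_
  -- Enlarging `X` and `Y` to terms of the filtration enlarges their wedge, which then lies in the
  -- term with the summed index.
  exact mem_filt_add fun g hg => hm (mem_wedge_iff.1 ha g fun y hy => hg y (hn hy))

end ChainConditions

end SuperCoalg

end

/-! ### The equivalence -/

theorem mainTheorem5 (k : Type*) [Field k] (hk : ringChar k ≠ 2)
    (A : Type*) [AddCommGroup A] [Module k A] [Coalgebra k A]
    (𝒜 : ZMod 2 → Submodule k A) [DirectSum.Decomposition 𝒜]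
    [SuperCoalg.IsSuperCoalgebra k 𝒜] (hA : SuperCoalg.IsSuperCocommutative k 𝒜) :
    List.TFAE [
      SuperCoalg.IsFiniteType k 𝒜,
      ∀ n : ℕ, FiniteDimensional k (SuperCoalg.coradFiltration k 𝒜 n),
      SuperCoalg.IsLocallyFinite k 𝒜 ∧
        FiniteDimensional k (SuperCoalg.coradFiltration k 𝒜 0),
      FiniteDimensional k (SuperCoalg.coradFiltration k 𝒜 0) ∧ SuperCoalg.IsReflexive k 𝒜,
      SuperCoalg.IsNoetherianSuper (SuperCoalg.dualGrading k 𝒜),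
      SuperCoalg.SubSuperCoalgebraDCC k 𝒜] := by
  have hgr := SuperCoalg.isGraded_coradMod 𝒜
  have h0 : SuperCoalg.coradFiltration k 𝒜 0 = (SuperCoalg.coradMod 𝒜).restrictScalars k := by
    rw [SuperCoalg.coradFiltration_eq 𝒜 hA, SuperCoalg.filt_one hA hgr]
  have h1 : SuperCoalg.IsFiniteType k 𝒜 ↔
      FiniteDimensional k ((SuperCoalg.filt (SuperCoalg.coradMod 𝒜) 2).restrictScalars k) := by
    rw [SuperCoalg.IsFiniteType, SuperCoalg.coradFiltration_eq 𝒜 hA]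
  tfae_have 1 → 2 := fun h n => by
    rw [SuperCoalg.coradFiltration_eq 𝒜 hA]
    exact SuperCoalg.finiteDimensional_filt hA hgr (h1.1 h) _
  tfae_have 2 → 1 := fun h => h 1
  tfae_have 2 → 3 := fun h =>
    ⟨SuperCoalg.isLocallyFinite_of_finite hA (h1.1 (h 1)), h 0⟩
  tfae_have 3 → 1 := fun h => by
    have hhom : (SuperCoalg.coradFiltration k 𝒜 0).IsHomogeneous 𝒜 := by
      rw [h0]
      exact SuperCoalg.isGraded_iff_isHomogeneous.1 hgr
    exact h.1 _ _ hhom hhom h.2 h.2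
  tfae_have 2 → 4 := fun h => ⟨h 0, SuperCoalg.isReflexive_of_finite hA (h1.1 (h 1))⟩
  tfae_have 4 → 1 := fun h =>
    h1.2 (SuperCoalg.finiteDimensional_filt_two_of_isReflexive hA hgr (h0 ▸ h.1) h.2)
  tfae_have 1 → 5 := fun h => by
    have := SuperCoalg.isNoetherianRing_dual hk hA (h1.1 h)
    exact SuperCoalg.isNoetherianSuper_of_isNoetherianRing _
  tfae_have 5 → 6 := SuperCoalg.subSuperCoalgebraDCC_of_isNoetherianSuper hA
  tfae_have 6 → 1 := fun h => h1.2 (SuperCoalg.finiteDimensional_filt_two_of_dcc hk hA h)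
  tfae_finish
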